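/- Notation. $\sigma_1,\sigma_2,\sigma_3$ are the Pauli matrices, $\|a\|:=\operatorname{tr}(a^\dagger a)$ (the sum of squared entries of a vector or matrix), $C$ is the cofactor matrix of $T$, and $$\{x,y,T\}=\tfrac14\Big[\mathbb I+\sum_i(x_i\,\sigma_i\otimes \mathbb I+y_i\,\mathbb I\otimes\sigma_i)+\sum_{i,j}t_{ij}\,\sigma_i\otimes\sigma_j\Big].$$ A two-qubit state is separable if it is a convex combination of product states $\alpha\otimes\beta$, and inseparable otherwise. For a two-qubit operator $\rho$ with entries $\rho_{m\mu,n\nu}$, $W_k(\rho)$ ($k=2,3,4$) is the leading $k\times k$ principal minor, in the basis $00,01,10,11$, of the partial transpose $\rho^T_{m\mu,n\nu}=\rho_{m\nu,n\mu}$. The optimal state-independent Buzek–Hillery cloner in dimension $M$ is $$|i\rangle\mapsto c\,|i\rangle|i\rangle|X_{ii}\rangle+d\sum_{j\ne i}\big(|i\rangle|j\rangle+|j\rangle|i\rangle\big)|Y_{ij}\rangle,\qquad c^2=\tfrac{2}{M+1},\quad d^2=\tfrac{1}{2(M+1)},\quad c,d>0,$$ with any machine vectors in a finite-dimensional Hilbert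 space such that $\langle X_{ii}|X_{ii}\rangle=\langle Y_{ij}|Y_{ij}\rangle=\langle X_{ii}|Y_{ji}\rangle=1$ and $\langle X_{ii}|Y_{ij}\rangle=\langle Y_{ji}|Y_{ij}\rangle=\langle X_{ii}|X_{jj}\rangle=0$ for $i\neq j$. Local cloning: the first party clones qubit 1 into qubits $1,3$ and the second party clones qubit 2 into qubits $2,4$, each with $M=2$. Nonlocal cloning: the register $(1,2)$ is cloned into the registers $(1,2)$ and $(3,4)$ with $M=4$. The machines are traced out, and $\tilde\rho_{ab}$ is the marginal on qubits $a,b$ (in $\tilde\rho_{23}$ for local cloning, the first party's qubit 3 is written as the first tensor factor). Theorem. Let $\rho_{12}$ be any two-qubit density operator and put $x_i=\operatorname{tr}[\rho_{12}(\sigma_i\otimes\mathbb I)]$, $y_i=\operatorname{tr}[\rho_{12}(\mathbb I\otimes\sigma_i)]$, $t_{ij}=\operatorname{tr}[\rho_{12}(\sigma_i\otimes\sigma_j)]$. Then $\rho_{12}=\{x,y,T\}$, and the following hold. (1) Local cloner. $\tilde\rho_{14}=\tilde\rho_{23}=\{\tfrac23x,\tfrac23y,\tfrac49T\}$, $\tilde\rho_{13}=\{\tfrac23x,\tfrac23x,\tfrac13\mathbb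 I_3\}$, $\tilde\rho_{24}=\{\tfrac23y,\tfrac23y,\tfrac13\mathbb I_3\}$. (a) $\tilde\rho_{13}$ is separable iff $0\le\|x\|\le\frac34$ and $\|x\|\le1+x_3+x_3^2$; $\tilde\rho_{24}$ is separable iff $0\le\|y\|\le\frac34$ and $\|y\|\le1+y_3+y_3^2$. (b) The determinants $W_2,W_3,W_4$ of $\tilde\rho_{14}$, and those of $\tilde\rho_{23}$, equal $W_2^l,W_3^l,W_4^l$ below, and each of $\tilde\rho_{14}$, $\tilde\rho_{23}$ is inseparable iff ($W^l_3<0$ or $W^l_4<0$) and $W^l_2\ge0$. (c) $\rho_{12}$ is optimally broadcast (that is, $\rho_{12},\tilde\rho_{14},\tilde\rho_{23}$ are inseparable and $\tilde\rho_{13},\tilde\rho_{24}$ separable) iff the conditions of (b) and both pairs of conditions of (a) hold. (2) Nonlocal cloner. $\tilde\rho_{12}=\tilde\rho_{34}=\{\tfrac35x,\tfrac35y,\tfrac35T\}$, $\tilde\rho_{13}=\{\tfrac35x,\tfrac35x,\tfrac15\mathbb I_3\}$, $\tilde\rho_{24}=\{\tfrac35y,\tfrac35y,\tfrac15\mathbb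 I_3\}$. (a) $\tilde\rho_{13}$ is separable iff $0\le\|x\|\le\frac89$ and $\|x\|-x_3^2\le\frac43(1+x_3)$; $\tilde\rho_{24}$ is separable iff $0\le\|y\|\le\frac89$ and $\|y\|-y_3^2\le\frac43(1+y_3)$. (b) The determinants $W_2,W_3,W_4$ of $\tilde\rho_{12}$, and those of $\tilde\rho_{34}$, equal $W_2^{nl},W_3^{nl},W_4^{nl}$ below, and each of $\tilde\rho_{12}$, $\tilde\rho_{34}$ is inseparable iff ($W^{nl}_3<0$ or $W^{nl}_4<0$) and $W^{nl}_2\ge0$. (c) $\rho_{12}$ is optimally broadcast (that is, the input $\rho_{12}$ and the outputs $\tilde\rho_{12},\tilde\rho_{34}$ are inseparable and $\tilde\rho_{13},\tilde\rho_{24}$ separable) iff the conditions of (b) and both pairs of conditions of (a) hold. Explicit determinants. $$W_2^l=\tfrac1{6^4}\Big[9(2x_3+3)^2-4\sum_{i}(2t_{3i}+3y_i)^2\Big],\qquad W_2^{nl}=\tfrac1{20^2}\Big[5(5+6x_3)-9\Big(\sum_i\{t_{3i}^2+y_i(2t_{3i}+y_i)\}-x_3^2\Big)\Big].$$ Put $p=t_{11}-t_{22}$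 and $q=t_{12}+t_{21}$. With $a=9+6x_3+6y_3+4t_{33}$, $b=9+6x_3-6y_3-4t_{33}$, $e=9-6x_3+6y_3-4t_{33}$, $u_i=3x_i+2t_{i3}$, $v_i=3y_i+2t_{3i}$, $$W_3^l=\tfrac1{36^3}\big[abe-16a(p^2+q^2)-4b(u_1^2+u_2^2)-4e(v_1^2+v_2^2)+32p(u_1v_1-u_2v_2)+32q(u_1v_2+u_2v_1)\big].$$ With $a=5+3x_3+3y_3+3t_{33}$, $b=5+3x_3-3y_3-3t_{33}$, $e=5-3x_3+3y_3-3t_{33}$, $u_i=x_i+t_{i3}$, $v_i=y_i+t_{3i}$, $$W_3^{nl}=\tfrac1{20^3}\big[abe-9a(p^2+q^2)-9b(u_1^2+u_2^2)-9e(v_1^2+v_2^2)+54p(u_1v_1-u_2v_2)+54q(u_1v_2+u_2v_1)\big].$$ Finally, $$W_4^l=\tfrac1{36^4}\big[(81-36\|x\|-36\|y\|-16\|T\|)^2+10368\,x^{\top}Ty+4608\det T-5184\|x\|\|y\|-2304(\|T^{\top}x\|+\|Ty\|)-1024\|C\|-4608\,x^{\top}Cy\big],$$ $$W_4^{nl}=\tfrac1{20^4}\big[(25-9\|x\|-9\|y\|-9\|T\|)^2+1080\,x^{\top}Ty+1080\det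 T-324\|x\|\|y\|-324(\|T^{\top}x\|+\|Ty\|)-324\|C\|-648\,x^{\top}Cy\big].$$ -/

import Mathlib

open Matrix
open scoped Kronecker ComplexOrder

noncomputable section

/-! ## Two-qubit states -/

/-- The Hilbert space index of two qubits; `(m, μ)` stands for the basis vector `|m μ⟩`. -/
abbrev TwoQubit : Type := Fin 2 × Fin 2

/-- The index `(q₁, q₂, q₃, q₄)` of the four output qubits. -/
abbrev FourQubit : Type := Fin 2 × Fin 2 × Fin 2 × Fin 2

/-- Density operators: positive semidefinite of trace one. -/
def IsDensityOperator {n : Type*} [Fintype n] (ρ : Matrix n n ℂ) : Prop :=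
  ρ.PosSemidef ∧ ρ.trace = 1

/-- The Pauli matrices `σ₁, σ₂, σ₃`. -/
def pauli : Fin 3 → Matrix (Fin 2) (Fin 2) ℂ :=
  ![!![0, 1; 1, 0], !![0, -Complex.I; Complex.I, 0], !![1, 0; 0, -1]]

/-- The operator `{x, y, T}`:
`(1/4) [ 1 + ∑ᵢ (xᵢ σᵢ ⊗ 1 + yᵢ 1 ⊗ σᵢ) + ∑ᵢⱼ tᵢⱼ σᵢ ⊗ σⱼ ]`. -/
def canonicalState (x y : Fin 3 → ℝ) (T : Matrix (Fin 3) (Fin 3) ℝ) :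
    Matrix TwoQubit TwoQubit ℂ :=
  (1 / 4 : ℂ) • (1
    + ∑ i, ((x i : ℂ) • (pauli i ⊗ₖ (1 : Matrix (Fin 2) (Fin 2) ℂ))
        + (y i : ℂ) • ((1 : Matrix (Fin 2) (Fin 2) ℂ) ⊗ₖ pauli i))
    + ∑ i, ∑ j, (T i j : ℂ) • (pauli i ⊗ₖ pauli j))

/-- `xᵢ = tr[ρ (σᵢ ⊗ 1)]` (a real number for Hermitian `ρ`). -/
def blochFirst (ρ : Matrix TwoQubit TwoQubit ℂ) : Fin 3 → ℝ :=
  fun i => (ρ * (pauli i ⊗ₖ (1 : Matrix (Fin 2) (Fin 2) ℂ))).trace.re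

/-- `yᵢ = tr[ρ (1 ⊗ σᵢ)]`. -/
def blochSecond (ρ : Matrix TwoQubit TwoQubit ℂ) : Fin 3 → ℝ :=
  fun i => (ρ * ((1 : Matrix (Fin 2) (Fin 2) ℂ) ⊗ₖ pauli i)).trace.re

/-- `tᵢⱼ = tr[ρ (σᵢ ⊗ σⱼ)]`. -/
def correlationMatrix (ρ : Matrix TwoQubit TwoQubit ℂ) : Matrix (Fin 3) (Fin 3) ℝ :=
  Matrix.of fun i j => (ρ * (pauli i ⊗ₖ pauli j)).trace.re

/-- Separability: a finite convex combination of products of one-qubit density operators. -/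
def IsSeparableState (ρ : Matrix TwoQubit TwoQubit ℂ) : Prop :=
  ρ ∈ convexHull ℝ {τ : Matrix TwoQubit TwoQubit ℂ |
    ∃ α β : Matrix (Fin 2) (Fin 2) ℂ,
      IsDensityOperator α ∧ IsDensityOperator β ∧ τ = α ⊗ₖ β}

/-! ## The Peres-Horodecki determinants

The leading principal minors of the partial transpose `ρ^T_{mμ,nν} = ρ_{mν,nμ}`. -/

def detW2 (ρ : Matrix TwoQubit TwoQubit ℂ) : ℂ :=
  det !![ρ (0, 0) (0, 0), ρ (0, 1) (0, 0);
         ρ (0, 0) (0, 1), ρ (0, 1) (0, 1)]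

def detW3 (ρ : Matrix TwoQubit TwoQubit ℂ) : ℂ :=
  det !![ρ (0, 0) (0, 0), ρ (0, 1) (0, 0), ρ (0, 0) (1, 0);
         ρ (0, 0) (0, 1), ρ (0, 1) (0, 1), ρ (0, 0) (1, 1);
         ρ (1, 0) (0, 0), ρ (1, 1) (0, 0), ρ (1, 0) (1, 0)]

def detW4 (ρ : Matrix TwoQubit TwoQubit ℂ) : ℂ :=
  det !![ρ (0, 0) (0, 0), ρ (0, 1) (0, 0), ρ (0, 0) (1, 0), ρ (0, 1) (1, 0);
         ρ (0, 0) (0, 1), ρ (0, 1) (0, 1), ρ (0, 0) (1, 1), ρ (0, 1) (1, 1);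
         ρ (1, 0) (0, 0), ρ (1, 1) (0, 0), ρ (1, 0) (1, 0), ρ (1, 1) (1, 0);
         ρ (1, 0) (0, 1), ρ (1, 1) (0, 1), ρ (1, 0) (1, 1), ρ (1, 1) (1, 1)]

/-! ## The Buzek-Hillery state independent cloner -/

/-- Machine vectors `|X_ii⟩`, `|Y_ij⟩` of the optimal state independent cloner
(`Y i i` is never used). -/
structure BHMachine (ι κ : Type*) [Fintype κ] where
  X : ι → EuclideanSpace ℂ κ
  Y : ι → ι → EuclideanSpace ℂ κ
  inner_X_self : ∀ i, inner ℂ (X i) (X i) = 1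
  inner_Y_self : ∀ i j, i ≠ j → inner ℂ (Y i j) (Y i j) = 1
  inner_X_Y_swap : ∀ i j, i ≠ j → inner ℂ (X i) (Y j i) = 1
  inner_X_Y : ∀ i j, i ≠ j → inner ℂ (X i) (Y i j) = 0
  inner_Y_Y_swap : ∀ i j, i ≠ j → inner ℂ (Y j i) (Y i j) = 0
  inner_X_X : ∀ i j, i ≠ j → inner ℂ (X i) (X j) = 0

/-- Such machine vectors exist: `X_ii = |i⟩` and `Y_ij = |j⟩` in an `M`-dimensional space. -/
def BHMachine.standard (ι : Type*) [Fintype ι] [DecidableEq ι] : BHMachine ι ι where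
  X i := EuclideanSpace.single i 1
  Y _ j := EuclideanSpace.single j 1
  inner_X_self i := by simp
  inner_Y_self i j _ := by simp
  inner_X_Y_swap i j _ := by simp
  inner_X_Y i j h := by simp [EuclideanSpace.inner_single_left, h]
  inner_Y_Y_swap i j h := by simp [EuclideanSpace.inner_single_left, h]
  inner_X_X i j h := by simp [EuclideanSpace.inner_single_left, h]

/-- The cloning transformation on `|Ψ_i⟩ |0⟩ |X⟩`, as the isometry
`|i⟩ ↦ c |i⟩|i⟩|X_ii⟩ + d ∑_{j ≠ i} (|i⟩|j⟩ + |j⟩|i⟩) |Y_ij⟩`,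
with `c = √(2/(M+1))`, `d = √(1/(2(M+1)))`, and `M` the dimension of the input.
Rows are indexed by ((first copy, second copy), machine). -/
def BHMachine.cloner {ι κ : Type*} [Fintype ι] [DecidableEq ι] [Fintype κ]
    (S : BHMachine ι κ) : Matrix ((ι × ι) × κ) ι ℂ :=
  Matrix.of fun r i =>
    (Real.sqrt (2 / ((Fintype.card ι : ℝ) + 1)) : ℂ)
        * ((if r.1 = (i, i) then 1 else 0) * S.X i r.2)
    + (Real.sqrt (1 / (2 * ((Fintype.card ι : ℝ) + 1))) : ℂ)
        * ∑ j ∈ Finset.univ.filter (fun j => j ≠ i),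
            ((if r.1 = (i, j) then 1 else 0) + (if r.1 = (j, i) then 1 else 0)) * S.Y i j r.2

/-- The four-qubit output of local cloning, both machines traced out: the first party clones
qubit 1 into qubits 1, 3, and the second party clones qubit 2 into qubits 2, 4. -/
def localOutput {κA κB : Type*} [Fintype κA] [Fintype κB]
    (A : BHMachine (Fin 2) κA) (B : BHMachine (Fin 2) κB)
    (ρ : Matrix TwoQubit TwoQubit ℂ) : Matrix FourQubit FourQubit ℂ :=
  Matrix.of fun (q₁, q₂, q₃, q₄) (r₁, r₂, r₃, r₄) => ∑ a : κA, ∑ b : κB,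
    ((A.cloner ⊗ₖ B.cloner) * ρ * (A.cloner ⊗ₖ B.cloner)ᴴ)
      (((q₁, q₃), a), ((q₂, q₄), b)) (((r₁, r₃), a), ((r₂, r₄), b))

/-- The four-qubit output of nonlocal cloning, machine traced out: the two-qubit register
`(1, 2)` is cloned into the registers `(1, 2)` and `(3, 4)`. -/
def nonlocalOutput {κ : Type*} [Fintype κ] (N : BHMachine TwoQubit κ)
    (ρ : Matrix TwoQubit TwoQubit ℂ) : Matrix FourQubit FourQubit ℂ :=
  Matrix.of fun (q₁, q₂, q₃, q₄) (r₁, r₂, r₃, r₄) => ∑ m : κ,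
    (N.cloner * ρ * N.clonerᴴ)
      (((q₁, q₂), (q₃, q₄)), m) (((r₁, r₂), (r₃, r₄)), m)

/-! ## Two-qubit marginals (the qubit named first is the first tensor factor) -/

def marginal12 (R : Matrix FourQubit FourQubit ℂ) : Matrix TwoQubit TwoQubit ℂ :=
  Matrix.of fun (q₁, q₂) (r₁, r₂) => ∑ s₃, ∑ s₄, R (q₁, q₂, s₃, s₄) (r₁, r₂, s₃, s₄)

def marginal34 (R : Matrix FourQubit FourQubit ℂ) : Matrix TwoQubit TwoQubit ℂ :=
  Matrix.of fun (q₃, q₄) (r₃, r₄) => ∑ s₁, ∑ s₂, R (s₁, s₂, q₃, q₄) (s₁, s₂, r₃, r₄)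

def marginal13 (R : Matrix FourQubit FourQubit ℂ) : Matrix TwoQubit TwoQubit ℂ :=
  Matrix.of fun (q₁, q₃) (r₁, r₃) => ∑ s₂, ∑ s₄, R (q₁, s₂, q₃, s₄) (r₁, s₂, r₃, s₄)

def marginal24 (R : Matrix FourQubit FourQubit ℂ) : Matrix TwoQubit TwoQubit ℂ :=
  Matrix.of fun (q₂, q₄) (r₂, r₄) => ∑ s₁, ∑ s₃, R (s₁, q₂, s₃, q₄) (s₁, r₂, s₃, r₄)

def marginal14 (R : Matrix FourQubit FourQubit ℂ) : Matrix TwoQubit TwoQubit ℂ :=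
  Matrix.of fun (q₁, q₄) (r₁, r₄) => ∑ s₂, ∑ s₃, R (q₁, s₂, s₃, q₄) (r₁, s₂, s₃, r₄)

/-- The state of qubits 2 and 3, with qubit 3 (held by the first party) as first factor. -/
def marginal32 (R : Matrix FourQubit FourQubit ℂ) : Matrix TwoQubit TwoQubit ℂ :=
  Matrix.of fun (q₃, q₂) (r₃, r₂) => ∑ s₁, ∑ s₄, R (s₁, q₂, q₃, s₄) (s₁, r₂, r₃, s₄)

/-! ## Optimal broadcasting of entanglement -/

/-- The input and the cross outputs are inseparable, and each party's own pair is separable. -/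
def BroadcastOptimallyLocally {κA κB : Type*} [Fintype κA] [Fintype κB]
    (A : BHMachine (Fin 2) κA) (B : BHMachine (Fin 2) κB)
    (ρ : Matrix TwoQubit TwoQubit ℂ) : Prop :=
  ¬ IsSeparableState ρ ∧
  (¬ IsSeparableState (marginal14 (localOutput A B ρ)) ∧
    ¬ IsSeparableState (marginal32 (localOutput A B ρ))) ∧
  (IsSeparableState (marginal13 (localOutput A B ρ)) ∧
    IsSeparableState (marginal24 (localOutput A B ρ)))

/-- The input and the desired outputs are inseparable, and the remaining outputs separable. -/
def BroadcastOptimallyNonlocally {κ : Type*} [Fintype κ] (N : BHMachine TwoQubit κ)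
    (ρ : Matrix TwoQubit TwoQubit ℂ) : Prop :=
  ¬ IsSeparableState ρ ∧
  (¬ IsSeparableState (marginal12 (nonlocalOutput N ρ)) ∧
    ¬ IsSeparableState (marginal34 (nonlocalOutput N ρ))) ∧
  (IsSeparableState (marginal13 (nonlocalOutput N ρ)) ∧
    IsSeparableState (marginal24 (nonlocalOutput N ρ)))

/-! ## The determinants as explicit polynomials in `x, y, T` -/

/-- `‖a‖ = tr(a† a)`, the sum of the squares of the entries. -/
def sqNorm (a : Fin 3 → ℝ) : ℝ := ∑ i, a i ^ 2

/-- `tr(T† T)`, the sum of the squares of the entries. -/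
def matSqNorm (T : Matrix (Fin 3) (Fin 3) ℝ) : ℝ := ∑ i, ∑ j, T i j ^ 2

section Polynomials

variable (x y : Fin 3 → ℝ) (T : Matrix (Fin 3) (Fin 3) ℝ)

def W2l : ℝ :=
  1 / 6 ^ 4 * (9 * (2 * x 2 + 3) ^ 2 - 4 * ∑ i, (2 * T 2 i + 3 * y i) ^ 2)

def W3l : ℝ :=
  1 / 36 ^ 3 *
    ((9 + 6 * x 2 + 6 * y 2 + 4 * T 2 2) * (9 + 6 * x 2 - 6 * y 2 - 4 * T 2 2)
        * (9 - 6 * x 2 + 6 * y 2 - 4 * T 2 2)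
      - 16 * (9 + 6 * x 2 + 6 * y 2 + 4 * T 2 2)
        * ((T 0 0 - T 1 1) ^ 2 + (T 0 1 + T 1 0) ^ 2)
      - 4 * (9 + 6 * x 2 - 6 * y 2 - 4 * T 2 2)
        * ((3 * x 0 + 2 * T 0 2) ^ 2 + (3 * x 1 + 2 * T 1 2) ^ 2)
      - 4 * (9 - 6 * x 2 + 6 * y 2 - 4 * T 2 2)
        * ((3 * y 0 + 2 * T 2 0) ^ 2 + (3 * y 1 + 2 * T 2 1) ^ 2)
      + 32 * (T 0 0 - T 1 1)
        * ((3 * x 0 + 2 * T 0 2) * (3 * y 0 + 2 * T 2 0)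
          - (3 * x 1 + 2 * T 1 2) * (3 * y 1 + 2 * T 2 1))
      + 32 * (T 0 1 + T 1 0)
        * ((3 * x 0 + 2 * T 0 2) * (3 * y 1 + 2 * T 2 1)
          + (3 * x 1 + 2 * T 1 2) * (3 * y 0 + 2 * T 2 0)))

def W4l : ℝ :=
  1 / 36 ^ 4 *
    ((81 - 36 * sqNorm x - 36 * sqNorm y - 16 * matSqNorm T) ^ 2
      + 10368 * (x ⬝ᵥ T *ᵥ y) + 4608 * T.det
      - 5184 * (sqNorm x * sqNorm y)
      - 2304 * (sqNorm (Tᵀ *ᵥ x) + sqNorm (T *ᵥ y))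
      - 1024 * matSqNorm T.adjugate
      - 4608 * (x ⬝ᵥ T.adjugateᵀ *ᵥ y))

def W2nl : ℝ :=
  1 / 20 ^ 2 *
    (5 * (5 + 6 * x 2) - 9 * (∑ i, (T 2 i ^ 2 + y i * (2 * T 2 i + y i)) - x 2 ^ 2))

def W3nl : ℝ :=
  1 / 20 ^ 3 *
    ((5 + 3 * x 2 + 3 * y 2 + 3 * T 2 2) * (5 + 3 * x 2 - 3 * y 2 - 3 * T 2 2)
        * (5 - 3 * x 2 + 3 * y 2 - 3 * T 2 2)
      - 9 * (5 + 3 * x 2 + 3 * y 2 + 3 * T 2 2)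
        * ((T 0 0 - T 1 1) ^ 2 + (T 0 1 + T 1 0) ^ 2)
      - 9 * (5 + 3 * x 2 - 3 * y 2 - 3 * T 2 2)
        * ((x 0 + T 0 2) ^ 2 + (x 1 + T 1 2) ^ 2)
      - 9 * (5 - 3 * x 2 + 3 * y 2 - 3 * T 2 2)
        * ((y 0 + T 2 0) ^ 2 + (y 1 + T 2 1) ^ 2)
      + 54 * (T 0 0 - T 1 1)
        * ((x 0 + T 0 2) * (y 0 + T 2 0) - (x 1 + T 1 2) * (y 1 + T 2 1))
      + 54 * (T 0 1 + T 1 0)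
        * ((x 0 + T 0 2) * (y 1 + T 2 1) + (x 1 + T 1 2) * (y 0 + T 2 0)))

def W4nl : ℝ :=
  1 / 20 ^ 4 *
    ((25 - 9 * sqNorm x - 9 * sqNorm y - 9 * matSqNorm T) ^ 2
      + 1080 * (x ⬝ᵥ T *ᵥ y) + 1080 * T.det
      - 324 * (sqNorm x * sqNorm y)
      - 324 * (sqNorm (Tᵀ *ᵥ x) + sqNorm (T *ᵥ y))
      - 324 * matSqNorm T.adjugate
      - 648 * (x ⬝ᵥ T.adjugateᵀ *ᵥ y))

end Polynomials

end

/-!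
The cloner turns out to be rigid: the prescribed inner products force `Y_ji = X_ii`
(`BHMachine.Y_eq_X`), and as `c = 2d` the transformation becomes
`|i⟩ ↦ d ∑ⱼ (|i⟩|j⟩ + |j⟩|i⟩) |X_jj⟩` with orthonormal `X_jj`. Its Gram kernel
(`BHMachine.sum_cloner_mul_star`) is then a sum of four products of Kronecker deltas, from which all
marginals are read off. The cross outputs are images of the input under depolarising channels
(`localShrink`, `nonlocalShrink`); they are positive definite, and separable if the input is.

Separability is decided by the Peres-Horodecki criterion
(`isSeparableState_iff_posSemidef_partialTranspose`), whose hard direction is obtained from the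
Krein-Milman theorem. Let `ρ` be an extreme point of the compact convex set of states with `ρ ≥ 0`
and `ρ^Γ ≥ 0`. If `ker ρ` and `ker ρ^Γ` are at most one-dimensional, then the conditions `tr H = 0`,
`ker ρ ⊆ ker H`, `ker ρ^Γ ⊆ ker H^Γ` on a Hermitian `H` amount to at most 15 real linear equations
in 16 unknowns, and `ρ ± ε H` stays in the set for a solution `H ≠ 0` and small `ε`, which
contradicts extremality. Otherwise one of the kernels has dimension at least two, hence contains a
product vector, and then `ρ` is visibly separable in adapted local bases
(`mem_separableCone_of_productVec`). The convex hull of product states is closed, by Carathéodory's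
theorem, so that it contains the whole set.

For a positive definite `ρ` the criterion reduces to the sign of `W₄ = det ρ^Γ`
(`posSemidef_partialTranspose_of_det_nonneg`): on a two-dimensional space where `ρ^Γ ≤ 0` there
would be a product vector, but on product vectors the form of `ρ^Γ` is positive like that of `ρ`.
For the states `{s x, s x, t 1}` of the remaining pairs, `ρ^Γ` is an explicit combination of
rank-one operators, and its determinant gives the converse. The determinants are evaluated by
expanding Hermitian `3 × 3` and `4 × 4` determinants.
-/

/-! ### Partial transposition and the cone of separable operators -/

/-- Partial transposition on the second tensor factor, `ρ^Γ_{mμ,nν} = ρ_{mν,nμ}`. -/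
def partialTranspose (ρ : Matrix TwoQubit TwoQubit ℂ) : Matrix TwoQubit TwoQubit ℂ :=
  Matrix.of fun p q => ρ (p.1, q.2) (q.1, p.2)

/-- The product vector `a ⊗ b`. -/
def productVec (a b : Fin 2 → ℂ) : TwoQubit → ℂ := fun p => a p.1 * b p.2

@[simp] lemma partialTranspose_apply (ρ : Matrix TwoQubit TwoQubit ℂ) (p q : TwoQubit) :
    partialTranspose ρ p q = ρ (p.1, q.2) (q.1, p.2) := rfl

@[simp] lemma partialTranspose_partialTranspose (ρ : Matrix TwoQubit TwoQubit ℂ) :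
    partialTranspose (partialTranspose ρ) = ρ := rfl

lemma partialTranspose_add (ρ σ : Matrix TwoQubit TwoQubit ℂ) :
    partialTranspose (ρ + σ) = partialTranspose ρ + partialTranspose σ := rfl

lemma partialTranspose_smul (c : ℝ) (ρ : Matrix TwoQubit TwoQubit ℂ) :
    partialTranspose (c • ρ) = c • partialTranspose ρ := rfl

lemma isHermitian_partialTranspose {ρ : Matrix TwoQubit TwoQubit ℂ} (h : ρ.IsHermitian) :
    (partialTranspose ρ).IsHermitian := by
  ext p q
  exact congrFun (congrFun h (p.1, q.2)) (q.1, p.2)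

lemma productVec_ne_zero {a b : Fin 2 → ℂ} (ha : a ≠ 0) (hb : b ≠ 0) : productVec a b ≠ 0 := by
  obtain ⟨i, hi⟩ := Function.ne_iff.1 ha
  obtain ⟨j, hj⟩ := Function.ne_iff.1 hb
  exact Function.ne_iff.2 ⟨(i, j), mul_ne_zero hi hj⟩

/-- On product vectors the forms of `ρ^Γ` and of `ρ` agree, up to conjugating the second factor. -/
lemma quadForm_partialTranspose_productVec (ρ : Matrix TwoQubit TwoQubit ℂ) (a b : Fin 2 → ℂ) :
    star (productVec a b) ⬝ᵥ partialTranspose ρ *ᵥ productVec a b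
      = star (productVec a (star b)) ⬝ᵥ ρ *ᵥ productVec a (star b) := by
  simp only [dotProduct, mulVec, partialTranspose_apply, productVec, Fintype.sum_prod_type,
    Fin.sum_univ_two, Pi.star_apply, star_mul', star_star]
  ring

/-- The cone generated by the products `α ⊗ β` of positive semidefinite operators. -/
def separableCone : AddSubmonoid (Matrix TwoQubit TwoQubit ℂ) :=
  AddSubmonoid.closure {τ | ∃ α β : Matrix (Fin 2) (Fin 2) ℂ,
    α.PosSemidef ∧ β.PosSemidef ∧ τ = α ⊗ₖ β}

lemma kronecker_mem_separableCone {α β : Matrix (Fin 2) (Fin 2) ℂ} (hα : α.PosSemidef)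
    (hβ : β.PosSemidef) : α ⊗ₖ β ∈ separableCone :=
  AddSubmonoid.subset_closure ⟨α, β, hα, hβ, rfl⟩

lemma posSemidef_real_smul {n : Type*} {c : ℝ} (hc : 0 ≤ c) {A : Matrix n n ℂ}
    (hA : A.PosSemidef) : (c • A).PosSemidef := by
  have h := hA.smul (a := (c : ℂ)) (by exact_mod_cast hc)
  rwa [Complex.coe_smul] at h

lemma smul_mem_separableCone {c : ℝ} (hc : 0 ≤ c) {τ : Matrix TwoQubit TwoQubit ℂ}
    (h : τ ∈ separableCone) : c • τ ∈ separableCone := by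
  induction h using AddSubmonoid.closure_induction with
  | mem τ h =>
    obtain ⟨α, β, hα, hβ, rfl⟩ := h
    rw [← smul_kronecker]
    exact kronecker_mem_separableCone (posSemidef_real_smul hc hα) hβ
  | zero => simp
  | add τ τ' _ _ h h' => rw [smul_add]; exact add_mem h h'

lemma partialTranspose_mem_separableCone {τ : Matrix TwoQubit TwoQubit ℂ}
    (h : τ ∈ separableCone) : partialTranspose τ ∈ separableCone := by
  induction h using AddSubmonoid.closure_induction with
  | mem τ h =>
    obtain ⟨α, β, hα, hβ, rfl⟩ := h
    -- `(α ⊗ β)^Γ` is `α ⊗ βᵀ` by definition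
    exact kronecker_mem_separableCone hα hβ.transpose
  | zero => exact zero_mem _
  | add τ τ' _ _ h h' => rw [partialTranspose_add]; exact add_mem h h'

lemma posSemidef_of_mem_separableCone {τ : Matrix TwoQubit TwoQubit ℂ}
    (h : τ ∈ separableCone) : τ.PosSemidef := by
  induction h using AddSubmonoid.closure_induction with
  | mem τ h =>
    obtain ⟨α, β, hα, hβ, rfl⟩ := h
    exact hα.kronecker hβ
  | zero => exact Matrix.PosSemidef.zero
  | add τ τ' _ _ h h' => exact h.add h'

/-- Local operators preserve the separable cone. -/
lemma conj_kronecker_mem_separableCone (U V : Matrix (Fin 2) (Fin 2) ℂ)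
    {τ : Matrix TwoQubit TwoQubit ℂ} (h : τ ∈ separableCone) :
    (U ⊗ₖ V) * τ * (U ⊗ₖ V)ᴴ ∈ separableCone := by
  induction h using AddSubmonoid.closure_induction with
  | mem τ h =>
    obtain ⟨α, β, hα, hβ, rfl⟩ := h
    rw [conjTranspose_kronecker, ← mul_kronecker_mul, ← mul_kronecker_mul]
    exact kronecker_mem_separableCone (hα.mul_mul_conjTranspose_same U)
      (hβ.mul_mul_conjTranspose_same V)
  | zero => simp
  | add τ τ' _ _ h h' => rw [mul_add, add_mul]; exact add_mem h h'

lemma IsSeparableState.mem_separableCone {τ : Matrix TwoQubit TwoQubit ℂ}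
    (h : IsSeparableState τ) : τ ∈ separableCone := by
  have hc : Convex ℝ (separableCone : Set (Matrix TwoQubit TwoQubit ℂ)) :=
    fun a ha b hb s t hs ht _ =>
      add_mem (smul_mem_separableCone hs ha) (smul_mem_separableCone ht hb)
  refine convexHull_min ?_ hc h
  rintro τ ⟨α, β, hα, hβ, rfl⟩
  exact kronecker_mem_separableCone hα.1 hβ.1

lemma exists_isDensityOperator : ∃ α : Matrix (Fin 2) (Fin 2) ℂ, IsDensityOperator α :=
  ⟨diagonal ![1, 0], Matrix.PosSemidef.diagonal (by intro i; fin_cases i <;> simp), by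
    simp [Matrix.trace]⟩

lemma posSemidef_eq_smul_isDensityOperator {α : Matrix (Fin 2) (Fin 2) ℂ} (h : α.PosSemidef) :
    ∃ (c : ℝ) (α' : Matrix (Fin 2) (Fin 2) ℂ), 0 ≤ c ∧ IsDensityOperator α' ∧ α = c • α' := by
  obtain ⟨hre, him⟩ := Complex.le_def.1 h.trace_nonneg
  have htr : α.trace = (α.trace.re : ℂ) := Complex.ext rfl (by simpa using him.symm)
  rcases hre.eq_or_lt with h0 | h0
  · obtain ⟨β, hβ⟩ := exists_isDensityOperator
    refine ⟨0, β, le_rfl, hβ, ?_⟩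
    rw [zero_smul]
    refine h.trace_eq_zero_iff.1 ?_
    rw [htr, ← h0]; simp
  · refine ⟨α.trace.re, α.trace.re⁻¹ • α, hre, ⟨posSemidef_real_smul (inv_nonneg.2 hre) h, ?_⟩, ?_⟩
    · have h0' : α.trace.re ≠ 0 := ne_of_gt h0
      rw [trace_smul, htr, Complex.ofReal_re, Complex.real_smul, ← Complex.ofReal_mul,
        inv_mul_cancel₀ h0', Complex.ofReal_one]
    · rw [smul_smul, mul_inv_cancel₀ (ne_of_gt h0), one_smul]

lemma IsSeparableState.trace_eq_one {τ : Matrix TwoQubit TwoQubit ℂ} (h : IsSeparableState τ) :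
    τ.trace = 1 := by
  have hc : Convex ℝ {τ : Matrix TwoQubit TwoQubit ℂ | τ.trace = 1} := by
    intro a ha b hb s t _ _ hst
    simp only [Set.mem_ofPred_eq] at ha hb ⊢
    rw [trace_add, trace_smul, trace_smul, ha, hb, ← add_smul, hst, one_smul]
  refine convexHull_min ?_ hc h
  rintro τ ⟨α, β, hα, hβ, rfl⟩
  simp [trace_kronecker, hα.2, hβ.2]

lemma exists_smul_isSeparableState {τ : Matrix TwoQubit TwoQubit ℂ} (h : τ ∈ separableCone) :
    ∃ (c : ℝ) (σ : Matrix TwoQubit TwoQubit ℂ), 0 ≤ c ∧ IsSeparableState σ ∧ τ = c • σ := by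
  have hne : ∃ σ, IsSeparableState σ := by
    obtain ⟨β, hβ⟩ := exists_isDensityOperator
    exact ⟨β ⊗ₖ β, subset_convexHull ℝ _ ⟨β, β, hβ, hβ, rfl⟩⟩
  induction h using AddSubmonoid.closure_induction with
  | mem τ h =>
    obtain ⟨α, β, hα, hβ, rfl⟩ := h
    obtain ⟨c, α', hc, hα', rfl⟩ := posSemidef_eq_smul_isDensityOperator hα
    obtain ⟨d, β', hd, hβ', rfl⟩ := posSemidef_eq_smul_isDensityOperator hβ
    refine ⟨c * d, α' ⊗ₖ β', by positivity, subset_convexHull ℝ _ ⟨α', β', hα', hβ', rfl⟩, ?_⟩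
    rw [smul_kronecker, kronecker_smul, smul_smul]
  | zero =>
    obtain ⟨σ, hσ⟩ := hne
    exact ⟨0, σ, le_rfl, hσ, by simp⟩
  | add τ τ' _ _ h h' =>
    obtain ⟨c, σ, hc, hσ, rfl⟩ := h
    obtain ⟨d, σ', hd, hσ', rfl⟩ := h'
    rcases (add_nonneg hc hd).eq_or_lt with h0 | h0
    · refine ⟨0, σ, le_rfl, hσ, ?_⟩
      rw [show c = 0 by linarith, show d = 0 by linarith]; simp
    · refine ⟨c + d, (c / (c + d)) • σ + (d / (c + d)) • σ', h0.le, ?_, ?_⟩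
      · exact convex_convexHull ℝ _ hσ hσ' (by positivity) (by positivity) (by field_simp)
      · rw [smul_add, smul_smul, smul_smul, mul_div_cancel₀ _ h0.ne', mul_div_cancel₀ _ h0.ne']

lemma isSeparableState_iff_mem_separableCone {τ : Matrix TwoQubit TwoQubit ℂ}
    (htr : τ.trace = 1) : IsSeparableState τ ↔ τ ∈ separableCone := by
  refine ⟨fun h => h.mem_separableCone, fun h => ?_⟩
  obtain ⟨c, σ, -, hσ, rfl⟩ := exists_smul_isSeparableState h
  have hc : c = 1 := by
    rw [trace_smul, hσ.trace_eq_one] at htr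
    simpa using congrArg Complex.re htr
  rwa [hc, one_smul]

/-! ### Positive partial transpose with a product vector in the kernel -/

lemma partialTranspose_mulVec_productVec_eq_zero {ρ : Matrix TwoQubit TwoQubit ℂ}
    (h' : (partialTranspose ρ).PosSemidef) {g k : Fin 2 → ℂ}
    (hk : ρ *ᵥ productVec g k = 0) :
    partialTranspose ρ *ᵥ productVec g (star k) = 0 := by
  rw [← h'.dotProduct_mulVec_zero_iff, quadForm_partialTranspose_productVec, star_star, hk]
  simp

lemma normSq_le_of_posSemidef {n : Type*} [Fintype n] {A : Matrix n n ℂ} (h : A.PosSemidef)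
    (i j : n) : Complex.normSq (A i j) ≤ (A i i).re * (A j j).re := by
  classical
  have hs := (h.submatrix ![i, j]).det_nonneg
  rw [det_fin_two] at hs
  have hji : A j i = star (A i j) := (h.1.apply j i).symm
  have hi : (A i i).im = 0 := by
    have := congrArg Complex.im (h.1.apply i i); simp at this; linarith
  have := (Complex.le_def.1 hs).1
  simp [hji, Complex.normSq_apply, hi] at this ⊢
  linarith

lemma diag_eq_ofReal {n : Type*} [Fintype n] {A : Matrix n n ℂ} (h : A.IsHermitian) (i : n) :
    A i i = ((A i i).re : ℂ) := by
  have := congrArg Complex.im (h.apply i i)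
  simp only [RCLike.star_def, Complex.conj_im] at this
  exact Complex.ext rfl (by simp only [Complex.ofReal_im]; linarith)

/-- A positive semidefinite operator supported on `|01⟩, |10⟩, |11⟩` without coherence between
`|01⟩` and `|10⟩` is a sum of three product operators, obtained by completing squares. -/
lemma mem_separableCone_of_support {ρ : Matrix TwoQubit TwoQubit ℂ} (h : ρ.PosSemidef)
    (h0 : ∀ p, ρ p (0, 0) = 0) (h1 : ρ (1, 0) (0, 1) = 0) : ρ ∈ separableCone := by
  have h0' : ∀ p, ρ (0, 0) p = 0 := fun p => by rw [← h.1.apply, h0, star_zero]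
  have h1' : ρ (0, 1) (1, 0) = 0 := by rw [← h.1.apply, h1, star_zero]
  set a := (ρ (0, 1) (0, 1)).re with ha
  set b := (ρ (1, 0) (1, 0)).re with hb
  set c := (ρ (1, 1) (1, 1)).re with hc
  set u := ρ (0, 1) (1, 1) with hu
  set v := ρ (1, 0) (1, 1) with hv
  have ea : ρ (0, 1) (0, 1) = a := diag_eq_ofReal h.1 _
  have eb : ρ (1, 0) (1, 0) = b := diag_eq_ofReal h.1 _
  have ec : ρ (1, 1) (1, 1) = c := diag_eq_ofReal h.1 _
  have eu : ρ (1, 1) (0, 1) = star u := (h.1.apply _ _).symm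
  have ev : ρ (1, 1) (1, 0) = star v := (h.1.apply _ _).symm
  have a0 : 0 ≤ a := by simpa using (Complex.le_def.1 (h.diag_nonneg (i := (0, 1)))).1
  have b0 : 0 ≤ b := by simpa using (Complex.le_def.1 (h.diag_nonneg (i := (1, 0)))).1
  have hua : a = 0 → u = 0 := fun h' => by
    have := normSq_le_of_posSemidef h (0, 1) (1, 1)
    rw [← ha, h', zero_mul] at this
    exact Complex.normSq_eq_zero.1 (le_antisymm this (Complex.normSq_nonneg _))
  have hvb : b = 0 → v = 0 := fun h' => by
    have := normSq_le_of_posSemidef h (1, 0) (1, 1)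
    rw [← hb, h', zero_mul] at this
    exact Complex.normSq_eq_zero.1 (le_antisymm this (Complex.normSq_nonneg _))
  -- When `a` or `b` vanishes, the division by zero below yields the value `0` that is wanted.
  set γ : ℝ := c - Complex.normSq u / a - Complex.normSq v / b with hγ
  have γ0 : 0 ≤ γ := by
    set w : TwoQubit → ℂ := fun p =>
      if p = (0, 1) then -u / a else if p = (1, 0) then -v / b else if p = (1, 1) then 1 else 0
      with hw
    have hq := h.dotProduct_mulVec_nonneg w
    have : star w ⬝ᵥ ρ *ᵥ w = (γ : ℂ) := by
      simp only [dotProduct, mulVec, Fintype.sum_prod_type, Fin.sum_univ_two, Pi.star_apply,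
        h0, h0', h1, h1', ea, eb, ec, eu, ev, ← hu, ← hv]
      have nu : ((Complex.normSq u : ℝ) : ℂ) = star u * u := by
        rw [Complex.normSq_eq_conj_mul_self]; rfl
      have nv : ((Complex.normSq v : ℝ) : ℂ) = star v * v := by
        rw [Complex.normSq_eq_conj_mul_self]; rfl
      simp only [hγ, hw]
      push_cast
      rw [nu, nv]
      rcases eq_or_ne a 0 with h' | h' <;> rcases eq_or_ne b 0 with h'' | h''
      · simp [hua h', hvb h'']
      · have : (b : ℂ) ≠ 0 := by exact_mod_cast h''
        simp [hua h']; field_simp; ring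
      · have : (a : ℂ) ≠ 0 := by exact_mod_cast h'
        simp [hvb h'']; field_simp; ring
      · have : (b : ℂ) ≠ 0 := by exact_mod_cast h''
        have : (a : ℂ) ≠ 0 := by exact_mod_cast h'
        simp; field_simp; ring
    rw [this] at hq
    exact_mod_cast hq
  set P : Matrix (Fin 2) (Fin 2) ℂ := vecMulVec ![0, 1] (star ![0, 1]) with hP
  have P0 : P.PosSemidef := posSemidef_vecMulVec_self_star _
  have hdecomp : ρ = (a⁻¹ • vecMulVec ![(a : ℂ), star u] (star ![(a : ℂ), star u])) ⊗ₖ P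
      + P ⊗ₖ (b⁻¹ • vecMulVec ![(b : ℂ), star v] (star ![(b : ℂ), star v]))
      + (γ • P) ⊗ₖ P := by
    have nu : ((Complex.normSq u : ℝ) : ℂ) = star u * u := by
      rw [Complex.normSq_eq_conj_mul_self]; rfl
    have nv : ((Complex.normSq v : ℝ) : ℂ) = star v * v := by
      rw [Complex.normSq_eq_conj_mul_self]; rfl
    have hua' : a ≠ 0 ∨ a = 0 ∧ u = 0 := (ne_or_eq a 0).imp_right fun h => ⟨h, hua h⟩
    have hvb' : b ≠ 0 ∨ b = 0 ∧ v = 0 := (ne_or_eq b 0).imp_right fun h => ⟨h, hvb h⟩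
    ext ⟨i, j⟩ ⟨k, l⟩
    simp only [Matrix.add_apply, kroneckerMap_apply, Matrix.smul_apply, vecMulVec_apply, hP,
      Pi.star_apply]
    fin_cases i <;> fin_cases j <;> fin_cases k <;> fin_cases l <;>
      simp [h0, h0', h1, h1', ea, eb, ec, eu, ev, ← hu, ← hv]
    · rcases hua' with h' | ⟨h', _⟩
      · have : (a : ℂ) ≠ 0 := by exact_mod_cast h'
        field_simp
      · simp [h']
    · rcases hua' with h' | ⟨_, h'⟩
      · have : (a : ℂ) ≠ 0 := by exact_mod_cast h'
        field_simp
      · simp [h']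
    · rcases hvb' with h' | ⟨h', _⟩
      · have : (b : ℂ) ≠ 0 := by exact_mod_cast h'
        field_simp
      · simp [h']
    · rcases hvb' with h' | ⟨_, h'⟩
      · have : (b : ℂ) ≠ 0 := by exact_mod_cast h'
        field_simp
      · simp [h']
    · rcases hua' with h' | ⟨_, h'⟩
      · have : (a : ℂ) ≠ 0 := by exact_mod_cast h'
        field_simp
      · simp [h']
    · rcases hvb' with h' | ⟨_, h'⟩
      · have : (b : ℂ) ≠ 0 := by exact_mod_cast h'
        field_simp
      · simp [h']
    · rw [hγ]; push_cast; rw [nu, nv]; simp only [RCLike.star_def]; ring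
  rw [hdecomp]
  exact add_mem (add_mem
    (kronecker_mem_separableCone
      (posSemidef_real_smul (by positivity) (posSemidef_vecMulVec_self_star _)) P0)
    (kronecker_mem_separableCone P0
      (posSemidef_real_smul (by positivity) (posSemidef_vecMulVec_self_star _))))
    (kronecker_mem_separableCone (posSemidef_real_smul γ0 P0) P0)

lemma exists_isUnit_col_zero {g : Fin 2 → ℂ} (hg : g ≠ 0) :
    ∃ U : Matrix (Fin 2) (Fin 2) ℂ, IsUnit U ∧ ∀ i, U i 0 = g i := by
  refine ⟨!![g 0, -star (g 1); g 1, star (g 0)], ?_, fun i => by fin_cases i <;> rfl⟩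
  rw [isUnit_iff_isUnit_det, det_fin_two, isUnit_iff_ne_zero]
  have : g 0 * star (g 0) - -star (g 1) * g 1
      = ((Complex.normSq (g 0) + Complex.normSq (g 1) : ℝ) : ℂ) := by
    push_cast
    rw [Complex.normSq_eq_conj_mul_self, Complex.normSq_eq_conj_mul_self]
    simp only [RCLike.star_def]; ring
  simp only [of_apply, cons_val', cons_val_zero, cons_val_one, cons_val_fin_one]
  rw [this]
  intro h
  have h : Complex.normSq (g 0) + Complex.normSq (g 1) = 0 := by exact_mod_cast h
  have h0 := Complex.normSq_nonneg (g 0)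
  have h1 := Complex.normSq_nonneg (g 1)
  apply hg
  funext i
  fin_cases i
  · exact Complex.normSq_eq_zero.1 (show Complex.normSq (g 0) = 0 by linarith)
  · exact Complex.normSq_eq_zero.1 (show Complex.normSq (g 1) = 0 by linarith)

lemma partialTranspose_conj_kronecker (U V : Matrix (Fin 2) (Fin 2) ℂ)
    (ρ : Matrix TwoQubit TwoQubit ℂ) :
    partialTranspose ((U ⊗ₖ V)ᴴ * ρ * (U ⊗ₖ V))
      = (U ⊗ₖ V.map star)ᴴ * partialTranspose ρ * (U ⊗ₖ V.map star) := by
  ext ⟨i, j⟩ ⟨k, l⟩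
  simp only [partialTranspose_apply, mul_apply, conjTranspose_apply, kroneckerMap_apply,
    Fintype.sum_prod_type, Fin.sum_univ_two, star_mul', map_apply, star_star]
  ring

/-- If `ρ` and `ρ^Γ` are positive semidefinite and a product vector is annihilated by `ρ`, then `ρ`
is separable: in local bases starting with the factors of that vector, `ρ^Γ` annihilates the
corresponding vector, and this kills the coherence between `|01⟩` and `|10⟩`. -/
theorem mem_separableCone_of_productVec {ρ : Matrix TwoQubit TwoQubit ℂ} (h : ρ.PosSemidef)
    (h' : (partialTranspose ρ).PosSemidef) {g k : Fin 2 → ℂ} (hg : g ≠ 0) (hk : k ≠ 0)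
    (hker : ρ *ᵥ productVec g k = 0) : ρ ∈ separableCone := by
  obtain ⟨U, hU, hU0⟩ := exists_isUnit_col_zero hg
  obtain ⟨V, hV, hV0⟩ := exists_isUnit_col_zero hk
  have hcol : ∀ (τ : Matrix TwoQubit TwoQubit ℂ) (V' : Matrix (Fin 2) (Fin 2) ℂ)
      (k' : Fin 2 → ℂ), (∀ i, V' i 0 = k' i) → τ *ᵥ productVec g k' = 0 →
      ∀ p, ((U ⊗ₖ V')ᴴ * τ * (U ⊗ₖ V')) p (0, 0) = 0 := by
    intro τ V' k' hk' hτ p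
    have : (fun q => (U ⊗ₖ V') q (0, 0)) = productVec g k' := by
      funext q; simp [productVec, kroneckerMap_apply, hU0, hk']
    have h2 : (((U ⊗ₖ V')ᴴ * τ) *ᵥ productVec g k') p = 0 := by
      rw [← mulVec_mulVec, hτ]; simp
    rw [← this] at h2
    exact h2
  have key : (U ⊗ₖ V)ᴴ * ρ * (U ⊗ₖ V) ∈ separableCone := by
    refine mem_separableCone_of_support (h.conjTranspose_mul_mul_same _) (hcol ρ V k hV0 hker) ?_
    have h2 := hcol (partialTranspose ρ) (V.map star) (star k) (fun i => by simp [hV0])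
      (partialTranspose_mulVec_productVec_eq_zero h' hker) (1, 1)
    rw [← partialTranspose_conj_kronecker] at h2
    exact h2
  have := conj_kronecker_mem_separableCone (U⁻¹)ᴴ (V⁻¹)ᴴ key
  have hUV : (U ⊗ₖ V) * (U⁻¹ ⊗ₖ V⁻¹) = 1 := by
    rw [← mul_kronecker_mul, mul_nonsing_inv _ ((isUnit_iff_isUnit_det _).1 hU),
      mul_nonsing_inv _ ((isUnit_iff_isUnit_det _).1 hV), one_kronecker_one]
  rw [← conjTranspose_kronecker, conjTranspose_conjTranspose] at this
  rw [show (U⁻¹ ⊗ₖ V⁻¹)ᴴ * ((U ⊗ₖ V)ᴴ * ρ * (U ⊗ₖ V)) * (U⁻¹ ⊗ₖ V⁻¹)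
    = ((U ⊗ₖ V) * (U⁻¹ ⊗ₖ V⁻¹))ᴴ * ρ * ((U ⊗ₖ V) * (U⁻¹ ⊗ₖ V⁻¹)) by
      rw [conjTranspose_mul]; simp only [Matrix.mul_assoc], hUV] at this
  simpa using this

/-! ### Convex hulls of compact sets in finite dimension -/

/-- By Carathéodory's theorem the convex hull is the image of the compact set
`stdSimplex × s ^ (finrank + 1)` under `(w, z) ↦ ∑ i, w i • z i`. -/
theorem isCompact_convexHull_of_isCompact {E : Type*} [AddCommGroup E] [Module ℝ E]
    [FiniteDimensional ℝ E] [TopologicalSpace E] [IsTopologicalAddGroup E] [ContinuousSMul ℝ E]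
    {s : Set E} (hs : IsCompact s) : IsCompact (convexHull ℝ s) := by
  rcases s.eq_empty_or_nonempty with rfl | ⟨e, he⟩
  · simp
  set n := Module.finrank ℝ E + 1
  have himg : convexHull ℝ s = (fun q : (Fin n → ℝ) × (Fin n → E) => ∑ i, q.1 i • q.2 i) ''
      (stdSimplex ℝ (Fin n) ×ˢ Set.univ.pi fun _ => s) := by
    apply Set.Subset.antisymm
    · intro x hx
      obtain ⟨ι, _, z, w, hz, hi, hw, hw1, hx⟩ := eq_pos_convex_span_of_mem_convexHull hx
      have hcard : Fintype.card ι ≤ Fintype.card (Fin n) := by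
        simpa [n] using hi.card_le_finrank_succ.trans
          (Nat.succ_le_succ (Submodule.finrank_le _))
      obtain ⟨f⟩ := Function.Embedding.nonempty_of_card_le hcard
      -- The weights and points are extended by `0` and by `e` outside the range of `f`.
      have hoff : ∀ i ∉ Set.range f, Function.extend f w 0 i = 0 := fun i hi =>
        Function.extend_apply' _ _ _ hi
      refine ⟨(Function.extend f w 0, Function.extend f z fun _ => e), ⟨⟨fun i => ?_, ?_⟩, ?_⟩, ?_⟩
      · by_cases hi : i ∈ Set.range f
        · obtain ⟨k, rfl⟩ := hi
          simp only [f.injective.extend_apply]; exact (hw k).le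
        · exact (hoff i hi).ge
      · rw [← hw1]
        exact (Fintype.sum_of_injective f f.injective _ _ hoff
          fun i => (f.injective.extend_apply _ _ _).symm).symm
      · intro i _
        by_cases hi : i ∈ Set.range f
        · obtain ⟨k, rfl⟩ := hi
          simp only [f.injective.extend_apply]; exact hz ⟨k, rfl⟩
        · simp only [Function.extend_apply' _ _ _ hi]; exact he
      · rw [← hx]
        refine (Fintype.sum_of_injective f f.injective _ _ (fun i hi => ?_) fun i => ?_).symm
        · simp only [hoff i hi, zero_smul]
        · simp only [f.injective.extend_apply]
    · rintro _ ⟨⟨w, z⟩, ⟨hw, hz⟩, rfl⟩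
      exact (convex_convexHull ℝ s).sum_mem (fun i _ => hw.1 i) hw.2
        fun i _ => subset_convexHull ℝ s (hz i (Set.mem_univ i))
  rw [himg]
  refine ((isCompact_stdSimplex ℝ (Fin n)).prod (isCompact_univ_pi fun _ => hs)).image ?_
  fun_prop

/-! ### Perturbing a positive semidefinite matrix -/

/-- A crude form of diagonal dominance: the form of `Z` is bounded by `∑ ‖Z i j‖` times the
squared norm. -/
lemma exists_one_add_smul_posSemidef {n : Type*} [Fintype n] [DecidableEq n] {Z : Matrix n n ℂ}
    (hZ : Z.IsHermitian) : ∃ ε > 0, ∀ t : ℝ, |t| ≤ ε → (1 + t • Z).PosSemidef := by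
  set C : ℝ := ∑ i, ∑ j, ‖Z i j‖ with hC
  have C0 : 0 ≤ C := by positivity
  refine ⟨1 / (C + 1), by positivity, fun t ht => ?_⟩
  have hH : (1 + t • Z).IsHermitian := isHermitian_one.add (by
    rw [IsHermitian, conjTranspose_smul, hZ.eq]; simp)
  refine PosSemidef.of_dotProduct_mulVec_nonneg hH fun v => ?_
  set S : ℝ := ∑ i, ‖v i‖ ^ 2 with hS
  have hbound : ‖star v ⬝ᵥ Z *ᵥ v‖ ≤ C * S := by
    have hle : ∀ i, ‖v i‖ ^ 2 ≤ S := fun i =>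
      Finset.single_le_sum (f := fun i => ‖v i‖ ^ 2) (fun _ _ => by positivity)
        (Finset.mem_univ i)
    have hv : ∀ i j, ‖v i‖ * ‖v j‖ ≤ S := by
      intro i j
      nlinarith [sq_nonneg (‖v i‖ - ‖v j‖), hle i, hle j]
    simp only [dotProduct, mulVec, Finset.mul_sum]
    rw [hC, Finset.sum_mul]
    refine (norm_sum_le _ _).trans (Finset.sum_le_sum fun i _ => ?_)
    rw [Finset.sum_mul]
    refine (norm_sum_le _ _).trans (Finset.sum_le_sum fun j _ => ?_)
    simp only [norm_mul, Pi.star_apply, norm_star]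
    calc ‖v i‖ * (‖Z i j‖ * ‖v j‖) = ‖Z i j‖ * (‖v i‖ * ‖v j‖) := by ring
      _ ≤ _ := mul_le_mul_of_nonneg_left (hv i j) (norm_nonneg _)
  have hone : star v ⬝ᵥ v = (S : ℂ) := by
    rw [hS, Complex.ofReal_sum]
    refine Finset.sum_congr rfl fun i _ => ?_
    rw [Pi.star_apply, RCLike.star_def, ← Complex.normSq_eq_conj_mul_self,
      Complex.normSq_eq_norm_sq]
  have him : (star v ⬝ᵥ (1 + t • Z) *ᵥ v).im = 0 := hH.im_star_dotProduct_mulVec_self v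
  have hre : (star v ⬝ᵥ (1 + t • Z) *ᵥ v).re = S + t * (star v ⬝ᵥ Z *ᵥ v).re := by
    rw [add_mulVec, one_mulVec, dotProduct_add, hone, smul_mulVec, dotProduct_smul]
    simp
  rw [Complex.le_def]
  refine ⟨?_, him.symm⟩
  rw [hre, Complex.zero_re]
  have S0 : 0 ≤ S := by positivity
  have h1 : |t * (star v ⬝ᵥ Z *ᵥ v).re| ≤ 1 / (C + 1) * (C * S) := by
    rw [abs_mul]
    exact mul_le_mul ht ((Complex.abs_re_le_norm _).trans hbound) (abs_nonneg _) (by positivity)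
  have h2 : 1 / (C + 1) * (C * S) ≤ S := by
    rw [div_mul_eq_mul_div, div_le_iff₀ (by positivity)]; nlinarith
  linarith [neg_abs_le (t * (star v ⬝ᵥ Z *ᵥ v).re)]

/-- If the kernel of `A ≥ 0` is contained in the kernel of the Hermitian matrix `H`, then
`A + t H ≥ 0` for small `t`. In an eigenbasis of `A` one has `H = √A Z √A`, so that
`A + t H = √A (1 + t Z) √A`. -/
theorem Matrix.PosSemidef.exists_add_smul_posSemidef {n : Type*} [Fintype n] [DecidableEq n]
    {A H : Matrix n n ℂ} (hA : A.PosSemidef) (hH : H.IsHermitian)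
    (hker : ∀ v, A *ᵥ v = 0 → H *ᵥ v = 0) :
    ∃ ε > 0, ∀ t : ℝ, |t| ≤ ε → (A + t • H).PosSemidef := by
  set U : Matrix n n ℂ := (hA.1.eigenvectorUnitary).1 with hU
  have hUU : U * Uᴴ = 1 := Unitary.mul_star_self_of_mem hA.1.eigenvectorUnitary.2
  set l := hA.1.eigenvalues with hl
  have l0 : ∀ i, 0 ≤ l i := hA.eigenvalues_nonneg
  have hAspec : A = U * diagonal (fun i => (l i : ℂ)) * Uᴴ := by
    conv_lhs => rw [hA.1.spectral_theorem]
    rfl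
  set G := Uᴴ * H * U with hG
  have hGH : G.IsHermitian := isHermitian_conjTranspose_mul_mul U hH
  have hG0 : ∀ i j, l j = 0 → G i j = 0 := by
    intro i j hj
    have h1 := hA.1.mulVec_eigenvectorBasis j
    rw [← hl, hj, zero_smul] at h1
    have h2 := hker _ h1
    have h3 : (fun k => U k j) = (hA.1.eigenvectorBasis j).ofLp := rfl
    rw [← h3] at h2
    have h4 : G i j = (Uᴴ *ᵥ (H *ᵥ fun k => U k j)) i := by
      rw [mulVec_mulVec]; rfl
    rw [h4, h2]; simp
  have hG0' : ∀ i j, l i = 0 → G i j = 0 := fun i j hi => by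
    rw [← hGH.apply, hG0 _ _ hi, star_zero]
  set D : Matrix n n ℂ := diagonal fun i => ((√(l i) : ℝ) : ℂ) with hD
  set Z : Matrix n n ℂ := Matrix.of fun i j => G i j * ((√(l i) * √(l j) : ℝ) : ℂ)⁻¹ with hZ
  have hZH : Z.IsHermitian := by
    ext i j
    simp only [hZ, conjTranspose_apply, of_apply, star_mul', hGH.apply]
    rw [mul_comm (√(l j))]
    simp [RCLike.star_def]
  have hDZD : D * Z * D = G := by
    ext i j
    rw [hD, mul_diagonal, diagonal_mul, hZ, of_apply]
    rcases (l0 i).eq_or_lt with hi | hi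
    · simp [hG0' i j hi.symm]
    rcases (l0 j).eq_or_lt with hj | hj
    · simp [hG0 i j hj.symm]
    have : ((√(l i) : ℝ) : ℂ) ≠ 0 := by exact_mod_cast (Real.sqrt_pos.2 hi).ne'
    have : ((√(l j) : ℝ) : ℂ) ≠ 0 := by exact_mod_cast (Real.sqrt_pos.2 hj).ne'
    push_cast
    field_simp
  have hDD : D * D = diagonal fun i => (l i : ℂ) := by
    rw [hD, diagonal_mul_diagonal]
    congr 1; funext i
    rw [← Complex.ofReal_mul, Real.mul_self_sqrt (l0 i)]
  have hDH : Dᴴ = D := by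
    rw [hD, diagonal_conjTranspose]; congr 1; funext i; simp
  obtain ⟨ε, hε, h⟩ := exists_one_add_smul_posSemidef hZH
  refine ⟨ε, hε, fun t ht => ?_⟩
  have h1 := ((h t ht).conjTranspose_mul_mul_same D).mul_mul_conjTranspose_same U
  rw [hDH, mul_add, add_mul, mul_one, hDD, Matrix.mul_smul, Matrix.smul_mul, hDZD, mul_add, add_mul,
    ← hAspec, Matrix.mul_smul, Matrix.smul_mul, hG] at h1
  rwa [show U * (Uᴴ * H * U) * Uᴴ = (U * Uᴴ) * H * (U * Uᴴ) by simp only [Matrix.mul_assoc], hUU,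
    one_mul, mul_one] at h1

/-! ### The Peres-Horodecki criterion -/

/-- A two-dimensional space of two-qubit vectors contains a product vector: the determinant of
`c • v + d • w`, read as a `2 × 2` matrix, is a binary quadratic form in `(c, d)`, and has
a nontrivial zero. -/
lemma exists_productVec_eq_combination {v w : TwoQubit → ℂ}
    (h : ∀ c d : ℂ, c • v + d • w = 0 → c = 0 ∧ d = 0) :
    ∃ (c d : ℂ) (g k : Fin 2 → ℂ), g ≠ 0 ∧ k ≠ 0 ∧ c • v + d • w = productVec g k := by
  -- a vector with vanishing determinant is a product vector
  have hprod : ∀ u : TwoQubit → ℂ, u ≠ 0 → u (0, 0) * u (1, 1) - u (0, 1) * u (1, 0) = 0 →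
      ∃ g k : Fin 2 → ℂ, g ≠ 0 ∧ k ≠ 0 ∧ u = productVec g k := by
    intro u hu hdet
    obtain ⟨⟨i, j⟩, hij⟩ := Function.ne_iff.1 hu
    have hij : u (i, j) ≠ 0 := hij
    refine ⟨fun m => u (m, j), fun n => u (i, n) / u (i, j), Function.ne_iff.2 ⟨i, hij⟩,
      Function.ne_iff.2 ⟨j, by simp [hij]⟩, ?_⟩
    funext ⟨m, n⟩
    simp only [productVec]
    field_simp
    revert hdet
    fin_cases i <;> fin_cases j <;> fin_cases m <;> fin_cases n <;> intro hdet <;>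
      simp only [Fin.zero_eta, Fin.mk_one] <;>
      first | ring1 | linear_combination hdet | linear_combination -hdet
  have hne : ∃ c d : ℂ, (c ≠ 0 ∨ d ≠ 0) ∧
      (c • v + d • w) (0, 0) * (c • v + d • w) (1, 1)
        - (c • v + d • w) (0, 1) * (c • v + d • w) (1, 0) = 0 := by
    simp only [Pi.add_apply, Pi.smul_apply, smul_eq_mul]
    by_cases ha : v (0, 0) * v (1, 1) - v (0, 1) * v (1, 0) = 0
    · exact ⟨1, 0, Or.inl one_ne_zero, by linear_combination ha⟩
    · obtain ⟨s, hs⟩ := IsAlgClosed.exists_eq_mul_self (discrim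
        (v (0, 0) * v (1, 1) - v (0, 1) * v (1, 0))
        (v (0, 0) * w (1, 1) + w (0, 0) * v (1, 1) - v (0, 1) * w (1, 0) - w (0, 1) * v (1, 0))
        (w (0, 0) * w (1, 1) - w (0, 1) * w (1, 0)))
      obtain ⟨c, hc⟩ := exists_quadratic_eq_zero ha ⟨s, hs⟩
      exact ⟨c, 1, Or.inr one_ne_zero, by linear_combination hc⟩
  obtain ⟨c, d, hcd, hdet⟩ := hne
  obtain ⟨g, k, hg, hk, e⟩ := hprod _ (fun h0 => by
    obtain ⟨hc, hd⟩ := h c d h0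
    exact hcd.elim (· hc) (· hd)) hdet
  exact ⟨c, d, g, k, hg, hk, e⟩

/-- Either the kernel of `τ` contains a product vector, or it lies in a line `ℂ k` (where `k ≠ 0` is
arbitrary if the kernel is trivial). -/
lemma exists_productVec_mem_ker_or_ker_le_span (τ : Matrix TwoQubit TwoQubit ℂ) :
    (∃ g k : Fin 2 → ℂ, g ≠ 0 ∧ k ≠ 0 ∧ τ *ᵥ productVec g k = 0) ∨
      ∃ k : TwoQubit → ℂ, k ≠ 0 ∧ ∀ v, τ *ᵥ v = 0 → ∃ c : ℂ, v = c • k := by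
  by_cases h : ∃ k, k ≠ 0 ∧ τ *ᵥ k = 0
  · obtain ⟨k, hk, hτ⟩ := h
    by_cases h2 : ∀ v, τ *ᵥ v = 0 → ∃ c : ℂ, v = c • k
    · exact Or.inr ⟨k, hk, h2⟩
    · push Not at h2
      obtain ⟨v, hv, hvk⟩ := h2
      left
      obtain ⟨c, d, g, l, hg, hl, e⟩ := exists_productVec_eq_combination (v := v) (w := k) (by
        intro c d hcd
        have hc : c = 0 := by
          by_contra hc
          refine hvk (-(c⁻¹ * d)) ?_
          have := congrArg (c⁻¹ • ·) (eq_neg_of_add_eq_zero_left hcd)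
          simpa [smul_smul, hc] using this
        subst hc
        refine ⟨rfl, ?_⟩
        simpa [hk] using hcd)
      refine ⟨g, l, hg, hl, ?_⟩
      rw [← e, mulVec_add, mulVec_smul, mulVec_smul, hv, hτ]
      simp
  · push Not at h
    refine Or.inr ⟨fun _ => 1, fun h => one_ne_zero (congrFun h (0, 0)), fun v hv => ⟨0, ?_⟩⟩
    rw [zero_smul]
    by_contra hv0
    exact h v hv0 hv

/-- The Hermitian matrix with real part `X + Xᵀ` and imaginary part `X - Xᵀ`. The map is a linear
bijection, so that `X` serves as `16` real coordinates of a Hermitian matrix. -/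
def hermitianOfReal (X : TwoQubit × TwoQubit → ℝ) : Matrix TwoQubit TwoQubit ℂ :=
  Matrix.of fun p q => ⟨X (p, q) + X (q, p), X (p, q) - X (q, p)⟩

lemma isHermitian_hermitianOfReal (X : TwoQubit × TwoQubit → ℝ) :
    (hermitianOfReal X).IsHermitian := by
  ext p q
  apply Complex.ext <;> simp [hermitianOfReal, add_comm]

lemma hermitianOfReal_eq_zero {X : TwoQubit × TwoQubit → ℝ} (h : hermitianOfReal X = 0) :
    X = 0 := by
  funext ⟨p, q⟩
  have h1 := congrArg Complex.re (congrFun (congrFun h p) q)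
  have h2 := congrArg Complex.im (congrFun (congrFun h p) q)
  simp [hermitianOfReal] at h1 h2 ⊢
  linarith

lemma hermitianOfReal_add (X Y : TwoQubit × TwoQubit → ℝ) :
    hermitianOfReal (X + Y) = hermitianOfReal X + hermitianOfReal Y := by
  ext p q
  apply Complex.ext <;> simp [hermitianOfReal] <;> ring

lemma hermitianOfReal_smul (c : ℝ) (X : TwoQubit × TwoQubit → ℝ) :
    hermitianOfReal (c • X) = c • hermitianOfReal X := by
  ext p q
  apply Complex.ext <;> simp [hermitianOfReal] <;> ring

/-- For a Hermitian matrix, `H k = 0` amounts to only seven real conditions, as `k† H k` is real. -/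
lemma mulVec_eq_zero_of_isHermitian {H : Matrix TwoQubit TwoQubit ℂ} (hH : H.IsHermitian)
    {k : TwoQubit → ℂ} {j : TwoQubit} (hj : k j ≠ 0) (h : ∀ i ≠ j, (H *ᵥ k) i = 0)
    (hre : (star k ⬝ᵥ H *ᵥ k).re = 0) : H *ᵥ k = 0 := by
  have h0 : star k ⬝ᵥ H *ᵥ k = 0 := Complex.ext hre (hH.im_star_dotProduct_mulVec_self k)
  rw [dotProduct, Finset.sum_eq_single j (fun i _ hi => by rw [h i hi, mul_zero])
    (fun hj => absurd (Finset.mem_univ j) hj)] at h0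
  funext i
  by_cases hi : i = j
  · subst hi
    exact (mul_eq_zero.1 h0).resolve_left (by simpa using hj)
  · exact h i hi

/-- There is a nonzero traceless Hermitian `H` with `H k = 0` and `H^Γ l = 0`: this imposes
`7 + 7 + 1 = 15` real linear conditions on `16` parameters. -/
lemma exists_isHermitian_mulVec_eq_zero {k l : TwoQubit → ℂ} (hk : k ≠ 0) (hl : l ≠ 0) :
    ∃ H : Matrix TwoQubit TwoQubit ℂ, H.IsHermitian ∧ H ≠ 0 ∧ H.trace = 0 ∧ H *ᵥ k = 0 ∧
      partialTranspose H *ᵥ l = 0 := by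
  obtain ⟨i, hi⟩ := Function.ne_iff.1 hk
  obtain ⟨j, hj⟩ := Function.ne_iff.1 hl
  let L : (TwoQubit × TwoQubit → ℝ) →ₗ[ℝ]
      ({p // p ≠ i} → ℂ) × ℝ × ({p // p ≠ j} → ℂ) × ℝ × ℝ :=
    { toFun := fun X =>
        (fun p => (hermitianOfReal X *ᵥ k) p, (star k ⬝ᵥ hermitianOfReal X *ᵥ k).re,
          fun p => (partialTranspose (hermitianOfReal X) *ᵥ l) p,
          (star l ⬝ᵥ partialTranspose (hermitianOfReal X) *ᵥ l).re, (hermitianOfReal X).trace.re)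
      map_add' := fun X Y => by
        simp only [hermitianOfReal_add, partialTranspose_add, add_mulVec, dotProduct_add, trace_add,
          Complex.add_re]
        rfl
      map_smul' := fun c X => by
        simp only [hermitianOfReal_smul, partialTranspose_smul, smul_mulVec, dotProduct_smul,
          trace_smul, Complex.smul_re]
        rfl }
  have hrank : Module.finrank ℝ (({p // p ≠ i} → ℂ) × ℝ × ({p // p ≠ j} → ℂ) × ℝ × ℝ)
      < Module.finrank ℝ (TwoQubit × TwoQubit → ℝ) := by
    simp [Module.finrank_pi_fintype, Complex.finrank_real_complex]
  obtain ⟨X, hX, hX0⟩ :=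
    (Submodule.ne_bot_iff _).1 (LinearMap.ker_ne_bot_of_finrank_lt (f := L) hrank)
  have hL : L X = 0 := hX
  simp only [L, LinearMap.coe_mk, AddHom.coe_mk, Prod.mk_eq_zero] at hL
  obtain ⟨h1, h2, h3, h4, h5⟩ := hL
  have hH := isHermitian_hermitianOfReal X
  refine ⟨hermitianOfReal X, hH, fun h => hX0 (hermitianOfReal_eq_zero h), Complex.ext h5 ?_,
    mulVec_eq_zero_of_isHermitian hH hi (fun p hp => congrFun h1 ⟨p, hp⟩) h2,
    mulVec_eq_zero_of_isHermitian (isHermitian_partialTranspose hH) hj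
      (fun p hp => congrFun h3 ⟨p, hp⟩) h4⟩
  simp [Matrix.trace, hermitianOfReal]

/-- The states with positive semidefinite partial transpose. -/
def pptStates : Set (Matrix TwoQubit TwoQubit ℂ) :=
  {τ | τ.PosSemidef ∧ (partialTranspose τ).PosSemidef ∧ τ.trace = 1}

lemma convex_pptStates : Convex ℝ pptStates := by
  rintro a ⟨ha, ha', hat⟩ b ⟨hb, hb', hbt⟩ s t hs ht hst
  refine ⟨(posSemidef_real_smul hs ha).add (posSemidef_real_smul ht hb), ?_, ?_⟩
  · rw [partialTranspose_add, partialTranspose_smul, partialTranspose_smul]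
    exact (posSemidef_real_smul hs ha').add (posSemidef_real_smul ht hb')
  · rw [trace_add, trace_smul, trace_smul, hat, hbt, ← add_smul, hst, one_smul]

lemma isClosed_setOf_posSemidef {n : Type*} [Fintype n] :
    IsClosed {A : Matrix n n ℂ | A.PosSemidef} := by
  have : {A : Matrix n n ℂ | A.PosSemidef}
      = {A | Aᴴ = A} ∩ ⋂ x : n → ℂ, {A | 0 ≤ star x ⬝ᵥ A *ᵥ x} := by
    ext A
    simp [posSemidef_iff_dotProduct_mulVec, IsHermitian]
  rw [this]
  exact (isClosed_eq (by fun_prop) (by fun_prop)).inter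
    (isClosed_iInter fun x => isClosed_le (by fun_prop) (by fun_prop))

lemma isCompact_setOf_isDensityOperator {n : Type*} [Fintype n] :
    IsCompact {A : Matrix n n ℂ | IsDensityOperator A} := by
  have hc : IsClosed {A : Matrix n n ℂ | IsDensityOperator A} :=
    isClosed_setOf_posSemidef.inter (isClosed_eq (by fun_prop) (by fun_prop))
  -- a density operator has entries of absolute value at most one
  refine IsCompact.of_isClosed_subset (isCompact_univ_pi fun _ : n => isCompact_univ_pi
    fun _ : n => isCompact_closedBall (0 : ℂ) 1) hc ?_
  rintro A ⟨hA, htr⟩ i - j -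
  have hd : ∀ i, 0 ≤ (A i i).re := fun i => (Complex.le_def.1 hA.diag_nonneg).1
  have hd1 : ∀ i, (A i i).re ≤ 1 := fun i => by
    rw [show (1 : ℝ) = A.trace.re by rw [htr]; rfl, Matrix.trace, Complex.re_sum]
    exact Finset.single_le_sum (f := fun i => (A i i).re) (fun i _ => hd i) (Finset.mem_univ i)
  have h := normSq_le_of_posSemidef hA i j
  rw [Complex.normSq_eq_norm_sq] at h
  rw [mem_closedBall_zero_iff]
  have : (A i i).re * (A j j).re ≤ 1 := mul_le_one₀ (hd1 i) (hd j) (hd1 j)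
  nlinarith [norm_nonneg (A i j)]

lemma isCompact_pptStates : IsCompact pptStates := by
  refine isCompact_setOf_isDensityOperator.of_isClosed_subset ?_ fun τ h => ⟨h.1, h.2.2⟩
  have hcont : Continuous partialTranspose :=
    continuous_pi fun p => continuous_pi fun q => by
      simp only [partialTranspose_apply]; fun_prop
  exact isClosed_setOf_posSemidef.inter ((isClosed_setOf_posSemidef.preimage hcont).inter
    (isClosed_eq (by fun_prop) (by fun_prop)))

lemma isCompact_setOf_isSeparableState : IsCompact {τ | IsSeparableState τ} := by
  refine isCompact_convexHull_of_isCompact ?_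
  have : {τ : Matrix TwoQubit TwoQubit ℂ | ∃ α β : Matrix (Fin 2) (Fin 2) ℂ,
      IsDensityOperator α ∧ IsDensityOperator β ∧ τ = α ⊗ₖ β}
      = (fun q : Matrix (Fin 2) (Fin 2) ℂ × Matrix (Fin 2) (Fin 2) ℂ => q.1 ⊗ₖ q.2) ''
        ({α | IsDensityOperator α} ×ˢ {β | IsDensityOperator β}) := by
    ext τ
    constructor
    · rintro ⟨α, β, hα, hβ, rfl⟩; exact ⟨(α, β), ⟨hα, hβ⟩, rfl⟩
    · rintro ⟨⟨α, β⟩, ⟨hα, hβ⟩, rfl⟩; exact ⟨α, β, hα, hβ, rfl⟩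
  rw [this]
  refine (isCompact_setOf_isDensityOperator.prod isCompact_setOf_isDensityOperator).image ?_
  exact continuous_pi fun p => continuous_pi fun q => by
    simp only [kroneckerMap_apply]; fun_prop

/-- An extreme point of the set of states with positive partial transpose is separable. If neither
`ρ` nor `ρ^Γ` annihilated a product vector, both kernels would be at most one-dimensional, and `ρ`
could be moved in both directions along some traceless `H`. -/
lemma isSeparableState_of_mem_extremePoints {ρ : Matrix TwoQubit TwoQubit ℂ}
    (h : ρ ∈ pptStates.extremePoints ℝ) : IsSeparableState ρ := by
  obtain ⟨⟨hρ, hρ', htr⟩, hext⟩ := h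
  rw [isSeparableState_iff_mem_separableCone htr]
  rcases exists_productVec_mem_ker_or_ker_le_span ρ with ⟨g, k, hg, hk, h0⟩ | ⟨k, hk, hker⟩
  · exact mem_separableCone_of_productVec hρ hρ' hg hk h0
  rcases exists_productVec_mem_ker_or_ker_le_span (partialTranspose ρ) with
    ⟨g, l, hg, hl, h0⟩ | ⟨l, hl, hker'⟩
  · exact partialTranspose_mem_separableCone (mem_separableCone_of_productVec hρ' hρ hg hl h0)
  exfalso
  obtain ⟨H, hH, hH0, hHtr, hHk, hHl⟩ := exists_isHermitian_mulVec_eq_zero hk hl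
  obtain ⟨ε, hε, h1⟩ := hρ.exists_add_smul_posSemidef hH fun v hv => by
    obtain ⟨c, rfl⟩ := hker v hv
    rw [mulVec_smul, hHk, smul_zero]
  obtain ⟨δ, hδ, h2⟩ := hρ'.exists_add_smul_posSemidef (isHermitian_partialTranspose hH)
    fun v hv => by
      obtain ⟨c, rfl⟩ := hker' v hv
      rw [mulVec_smul, hHl, smul_zero]
  have hmem : ∀ t : ℝ, |t| ≤ min ε δ → ρ + t • H ∈ pptStates := fun t ht =>
    ⟨h1 t (ht.trans (min_le_left _ _)), h2 t (ht.trans (min_le_right _ _)), by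
      rw [trace_add, trace_smul, hHtr, smul_zero, add_zero, htr]⟩
  have hpos : 0 < min ε δ := lt_min hε hδ
  have e := hext (hmem (min ε δ) (abs_of_pos hpos).le)
    (hmem (-min ε δ) (by rw [abs_neg, abs_of_pos hpos])) ⟨1 / 2, 1 / 2, by norm_num, by norm_num,
      by norm_num, by module⟩
  have : (min ε δ) • H = 0 := by simpa using e
  exact hH0 ((smul_eq_zero.1 this).resolve_left hpos.ne')

/-- The Peres-Horodecki criterion for two qubits. -/
theorem isSeparableState_iff_posSemidef_partialTranspose {ρ : Matrix TwoQubit TwoQubit ℂ}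
    (hρ : IsDensityOperator ρ) : IsSeparableState ρ ↔ (partialTranspose ρ).PosSemidef := by
  refine ⟨fun h => posSemidef_of_mem_separableCone
    (partialTranspose_mem_separableCone h.mem_separableCone), fun h => ?_⟩
  -- `Matrix` carries the product topology, but no global norm to infer local convexity from
  have : LocallyConvexSpace ℝ (Matrix TwoQubit TwoQubit ℂ) := by
    let _ := @Matrix.normedAddCommGroup TwoQubit TwoQubit ℂ
    let _ := @Matrix.normedSpace ℝ TwoQubit TwoQubit ℂ
    exact NormedSpace.toLocallyConvexSpace
  have hmem : ρ ∈ pptStates := ⟨hρ.1, h, hρ.2⟩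
  rw [← closure_convexHull_extremePoints isCompact_pptStates convex_pptStates] at hmem
  exact closure_minimal (convexHull_min (fun τ => isSeparableState_of_mem_extremePoints)
    (convex_convexHull ℝ _)) isCompact_setOf_isSeparableState.isClosed hmem

/-! ### The determinant criterion -/

/-- If `ρ` is positive definite and `det ρ^Γ ≥ 0`, then `ρ^Γ` is positive semidefinite. Otherwise
`ρ^Γ` would have a negative eigenvalue and a further eigenvalue `≤ 0`, hence a nonpositive form on a
two-dimensional space; but such a space contains a product vector, where the form of `ρ^Γ` is
positive because that of `ρ` is. -/
theorem posSemidef_partialTranspose_of_det_nonneg {ρ : Matrix TwoQubit TwoQubit ℂ} (hρ : ρ.PosDef)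
    (hdet : 0 ≤ (partialTranspose ρ).det.re) : (partialTranspose ρ).PosSemidef := by
  have hH := isHermitian_partialTranspose hρ.1
  set l := hH.eigenvalues with hl
  rw [hH.posSemidef_iff_eigenvalues_nonneg]
  by_contra hneg
  obtain ⟨i, hi⟩ : ∃ i, l i < 0 := by
    by_contra hall
    push Not at hall
    exact hneg hall
  -- otherwise the determinant, the product of the eigenvalues, would be negative
  obtain ⟨j, hji, hj⟩ : ∃ j, j ≠ i ∧ l j ≤ 0 := by
    by_contra hall
    push Not at hall
    rw [hH.det_eq_prod_eigenvalues, ← Finset.mul_prod_erase _ _ (Finset.mem_univ i)] at hdet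
    have hpos : 0 < ∏ j ∈ Finset.univ.erase i, l j :=
      Finset.prod_pos fun j hj => hall j (Finset.ne_of_mem_erase hj)
    have : (((l i : ℝ) : ℂ) * ∏ j ∈ Finset.univ.erase i, ((l j : ℝ) : ℂ)).re
        = l i * ∏ j ∈ Finset.univ.erase i, l j := by
      rw [← Complex.ofReal_prod, ← Complex.ofReal_mul, Complex.ofReal_re]
    have h2 := hdet.trans_eq this
    nlinarith
  set v : TwoQubit → ℂ := (hH.eigenvectorBasis i).ofLp with hv
  set w : TwoQubit → ℂ := (hH.eigenvectorBasis j).ofLp with hw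
  have horth : ∀ a b, star (hH.eigenvectorBasis a).ofLp ⬝ᵥ (hH.eigenvectorBasis b).ofLp
      = if a = b then 1 else 0 := fun a b => by
    rw [← orthonormal_iff_ite.1 hH.eigenvectorBasis.orthonormal a b,
      EuclideanSpace.inner_eq_star_dotProduct, dotProduct_comm]
  have hvv : star v ⬝ᵥ v = 1 := by rw [hv, horth, if_pos rfl]
  have hww : star w ⬝ᵥ w = 1 := by rw [hw, horth, if_pos rfl]
  have hvw : star v ⬝ᵥ w = 0 := by rw [hv, hw, horth, if_neg hji.symm]
  have hwv : star w ⬝ᵥ v = 0 := by rw [hv, hw, horth, if_neg hji]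
  obtain ⟨c, d, g, k, hg, hk, e⟩ := exists_productVec_eq_combination (v := v) (w := w) (by
    intro c d h
    have h1 := congrArg (star v ⬝ᵥ ·) h
    have h2 := congrArg (star w ⬝ᵥ ·) h
    simp only [dotProduct_add, dotProduct_smul, hvv, hww, hvw, hwv, dotProduct_zero] at h1 h2
    exact ⟨by simpa using h1, by simpa using h2⟩)
  have hpos := hρ.dotProduct_mulVec_pos (productVec_ne_zero hg (star_ne_zero.2 hk))
  rw [← quadForm_partialTranspose_productVec, ← e, mulVec_add, mulVec_smul, mulVec_smul, hv, hw,
    hH.mulVec_eigenvectorBasis, hH.mulVec_eigenvectorBasis, ← hv, ← hw, ← hl] at hpos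
  simp only [star_add, star_smul, add_dotProduct, smul_dotProduct, dotProduct_add,
    dotProduct_smul, hvv, hww, hvw, hwv] at hpos
  have h1 := (Complex.lt_def.1 hpos).1
  simp only [RCLike.star_def, smul_eq_mul, Complex.real_smul, mul_one, mul_zero, add_zero, zero_add,
    Complex.add_re, Complex.zero_re] at h1
  have hc : ∀ (z : ℂ) (r : ℝ), (z * ((r : ℂ) * starRingEnd ℂ z)).re = Complex.normSq z * r := by
    intro z r
    rw [mul_left_comm, Complex.mul_conj, ← Complex.ofReal_mul, Complex.ofReal_re, mul_comm]
  simp only [hc] at h1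
  nlinarith [Complex.normSq_nonneg c, Complex.normSq_nonneg d]

lemma detW2_eq (ρ : Matrix TwoQubit TwoQubit ℂ) :
    detW2 ρ = (ρ.submatrix ![(0, 0), (0, 1)] ![(0, 0), (0, 1)]).det := by
  rw [← det_transpose, detW2]
  congr 1
  ext i j; fin_cases i <;> fin_cases j <;> rfl

lemma detW3_eq (ρ : Matrix TwoQubit TwoQubit ℂ) :
    detW3 ρ = ((partialTranspose ρ).submatrix ![(0, 0), (0, 1), (1, 0)]
      ![(0, 0), (0, 1), (1, 0)]).det := by
  rw [detW3]
  congr 1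
  ext i j; fin_cases i <;> fin_cases j <;> rfl

lemma detW4_eq (ρ : Matrix TwoQubit TwoQubit ℂ) : detW4 ρ = (partialTranspose ρ).det := by
  rw [← det_submatrix_equiv_self (finProdFinEquiv (m := 2) (n := 2)).symm, detW4]
  congr 1
  ext i j; fin_cases i <;> fin_cases j <;> rfl

/-- For a positive definite state `W₂ ≥ 0` always holds, and inseparability amounts to `W₄ < 0`. -/
theorem not_isSeparableState_iff_of_detW {ρ : Matrix TwoQubit TwoQubit ℂ} (hρ : ρ.PosDef)
    (htr : ρ.trace = 1) {w₂ w₃ w₄ : ℝ} (h2 : detW2 ρ = w₂) (h3 : detW3 ρ = w₃)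
    (h4 : detW4 ρ = w₄) : ¬ IsSeparableState ρ ↔ (w₃ < 0 ∨ w₄ < 0) ∧ 0 ≤ w₂ := by
  rw [isSeparableState_iff_posSemidef_partialTranspose ⟨hρ.posSemidef, htr⟩]
  have hw2 : 0 ≤ w₂ := by
    have := (hρ.posSemidef.submatrix ![(0, 0), (0, 1)]).det_nonneg
    rw [← detW2_eq, h2] at this
    exact_mod_cast this
  constructor
  · intro h
    refine ⟨Or.inr ?_, hw2⟩
    by_contra hw
    refine h (posSemidef_partialTranspose_of_det_nonneg hρ ?_)
    rw [← detW4_eq, h4]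
    simpa using hw
  · rintro ⟨h, -⟩ hp
    have h3' := (hp.submatrix ![(0, 0), (0, 1), (1, 0)]).det_nonneg
    have h4' := hp.det_nonneg
    rw [← detW3_eq, h3] at h3'
    rw [← detW4_eq, h4] at h4'
    have h3'' : 0 ≤ w₃ := by exact_mod_cast h3'
    have h4'' : 0 ≤ w₄ := by exact_mod_cast h4'
    rcases h with h | h <;> linarith

/-! ### The determinants as polynomials -/

/-- The entries of `{x, y, T}` in the computational basis, as real and imaginary parts. -/
lemma canonicalState_apply (x y : Fin 3 → ℝ) (T : Matrix (Fin 3) (Fin 3) ℝ) :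
    (canonicalState x y T (0, 0) (0, 0) = ⟨(1 + x 2 + y 2 + T 2 2) / 4, 0⟩ ∧
     canonicalState x y T (0, 1) (0, 1) = ⟨(1 + x 2 - y 2 - T 2 2) / 4, 0⟩ ∧
     canonicalState x y T (1, 0) (1, 0) = ⟨(1 - x 2 + y 2 - T 2 2) / 4, 0⟩ ∧
     canonicalState x y T (1, 1) (1, 1) = ⟨(1 - x 2 - y 2 + T 2 2) / 4, 0⟩) ∧
    (canonicalState x y T (0, 0) (0, 1) = ⟨(y 0 + T 2 0) / 4, -(y 1 + T 2 1) / 4⟩ ∧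
     canonicalState x y T (0, 1) (0, 0) = ⟨(y 0 + T 2 0) / 4, (y 1 + T 2 1) / 4⟩) ∧
    (canonicalState x y T (0, 0) (1, 0) = ⟨(x 0 + T 0 2) / 4, -(x 1 + T 1 2) / 4⟩ ∧
     canonicalState x y T (1, 0) (0, 0) = ⟨(x 0 + T 0 2) / 4, (x 1 + T 1 2) / 4⟩) ∧
    (canonicalState x y T (0, 0) (1, 1) = ⟨(T 0 0 - T 1 1) / 4, -(T 0 1 + T 1 0) / 4⟩ ∧
     canonicalState x y T (1, 1) (0, 0) = ⟨(T 0 0 - T 1 1) / 4, (T 0 1 + T 1 0) / 4⟩) ∧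
    (canonicalState x y T (0, 1) (1, 0) = ⟨(T 0 0 + T 1 1) / 4, (T 0 1 - T 1 0) / 4⟩ ∧
     canonicalState x y T (1, 0) (0, 1) = ⟨(T 0 0 + T 1 1) / 4, -(T 0 1 - T 1 0) / 4⟩) ∧
    (canonicalState x y T (0, 1) (1, 1) = ⟨(x 0 - T 0 2) / 4, -(x 1 - T 1 2) / 4⟩ ∧
     canonicalState x y T (1, 1) (0, 1) = ⟨(x 0 - T 0 2) / 4, (x 1 - T 1 2) / 4⟩) ∧
    (canonicalState x y T (1, 0) (1, 1) = ⟨(y 0 - T 2 0) / 4, -(y 1 - T 2 1) / 4⟩ ∧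
     canonicalState x y T (1, 1) (1, 0) = ⟨(y 0 - T 2 0) / 4, (y 1 - T 2 1) / 4⟩) := by
  refine ⟨⟨?_, ?_, ?_, ?_⟩, ⟨?_, ?_⟩, ⟨?_, ?_⟩, ⟨?_, ?_⟩, ⟨?_, ?_⟩, ⟨?_, ?_⟩, ⟨?_, ?_⟩⟩ <;>
  · apply Complex.ext <;>
      simp [canonicalState, pauli, Fin.sum_univ_three, kroneckerMap_apply] <;>
      ring

lemma det_hermitian_three (d₀ d₁ d₂ : ℝ) (z₀₁ z₀₂ z₁₂ : ℂ) :
    det !![(d₀ : ℂ), z₀₁, z₀₂; star z₀₁, (d₁ : ℂ), z₁₂; star z₀₂, star z₁₂, (d₂ : ℂ)]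
      = ((d₀ * d₁ * d₂ - d₂ * Complex.normSq z₀₁ - d₁ * Complex.normSq z₀₂
          - d₀ * Complex.normSq z₁₂ + 2 * (z₀₁ * z₁₂ * star z₀₂).re : ℝ) : ℂ) := by
  rw [det_fin_three]
  have h2 : ∀ z : ℂ, 2 * (z.re : ℂ) = z + star z := fun z => (by
    rw [RCLike.star_def, Complex.add_conj]; push_cast; ring)
  push_cast
  rw [h2]
  simp only [Complex.normSq_eq_conj_mul_self, star_mul', RCLike.star_def, Complex.conj_conj]
  simp
  ring

lemma det_hermitian_four (d₀ d₁ d₂ d₃ : ℝ) (z₀₁ z₀₂ z₀₃ z₁₂ z₁₃ z₂₃ : ℂ) :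
    det !![(d₀ : ℂ), z₀₁, z₀₂, z₀₃; star z₀₁, (d₁ : ℂ), z₁₂, z₁₃;
        star z₀₂, star z₁₂, (d₂ : ℂ), z₂₃; star z₀₃, star z₁₃, star z₂₃, (d₃ : ℂ)]
      = ((d₀ * d₁ * d₂ * d₃
          - d₂ * d₃ * Complex.normSq z₀₁ - d₁ * d₃ * Complex.normSq z₀₂
          - d₁ * d₂ * Complex.normSq z₀₃ - d₀ * d₃ * Complex.normSq z₁₂
          - d₀ * d₂ * Complex.normSq z₁₃ - d₀ * d₁ * Complex.normSq z₂₃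
          + Complex.normSq z₀₁ * Complex.normSq z₂₃ + Complex.normSq z₀₂ * Complex.normSq z₁₃
          + Complex.normSq z₀₃ * Complex.normSq z₁₂
          + d₃ * (2 * (z₀₁ * z₁₂ * star z₀₂).re) + d₂ * (2 * (z₀₁ * z₁₃ * star z₀₃).re)
          + d₁ * (2 * (z₀₂ * z₂₃ * star z₀₃).re) + d₀ * (2 * (z₁₂ * z₂₃ * star z₁₃).re)
          - 2 * (z₀₁ * z₁₂ * z₂₃ * star z₀₃).re - 2 * (z₀₁ * z₁₃ * star z₂₃ * star z₀₂).re
          - 2 * (z₀₂ * star z₁₂ * z₁₃ * star z₀₃).re : ℝ) : ℂ) := by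
  have h2 : ∀ z : ℂ, 2 * (z.re : ℂ) = z + star z := fun z => (by
    rw [RCLike.star_def, Complex.add_conj]; push_cast; ring)
  rw [det_succ_row_zero]
  push_cast
  simp only [h2]
  simp only [Complex.normSq_eq_conj_mul_self, star_mul', RCLike.star_def, Complex.conj_conj]
  simp [det_fin_three, Fin.sum_univ_succ, Fin.succAbove]
  ring

/-- The minor `W₃` of `{x, y, T}`. -/
lemma detW3_canonicalState (x y : Fin 3 → ℝ) (T : Matrix (Fin 3) (Fin 3) ℝ) :
    detW3 (canonicalState x y T) = ((1 / 4 ^ 3 *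
      ((1 + x 2 + y 2 + T 2 2) * (1 + x 2 - y 2 - T 2 2) * (1 - x 2 + y 2 - T 2 2)
        - (1 + x 2 + y 2 + T 2 2) * ((T 0 0 - T 1 1) ^ 2 + (T 0 1 + T 1 0) ^ 2)
        - (1 + x 2 - y 2 - T 2 2) * ((x 0 + T 0 2) ^ 2 + (x 1 + T 1 2) ^ 2)
        - (1 - x 2 + y 2 - T 2 2) * ((y 0 + T 2 0) ^ 2 + (y 1 + T 2 1) ^ 2)
        + 2 * (T 0 0 - T 1 1)
          * ((x 0 + T 0 2) * (y 0 + T 2 0) - (x 1 + T 1 2) * (y 1 + T 2 1))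
        + 2 * (T 0 1 + T 1 0)
          * ((x 0 + T 0 2) * (y 1 + T 2 1) + (x 1 + T 1 2) * (y 0 + T 2 0))) : ℝ) : ℂ) := by
  obtain ⟨⟨a0, a1, a2, a3⟩, ⟨b, b'⟩, ⟨c, c'⟩, ⟨d, d'⟩, ⟨e, e'⟩, ⟨f, f'⟩, ⟨g, g'⟩⟩ :=
    canonicalState_apply x y T
  have key := det_hermitian_three ((1 + x 2 + y 2 + T 2 2) / 4) ((1 + x 2 - y 2 - T 2 2) / 4)
    ((1 - x 2 + y 2 - T 2 2) / 4) ⟨(y 0 + T 2 0) / 4, (y 1 + T 2 1) / 4⟩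
    ⟨(x 0 + T 0 2) / 4, -(x 1 + T 1 2) / 4⟩ ⟨(T 0 0 - T 1 1) / 4, -(T 0 1 + T 1 0) / 4⟩
  refine Eq.trans ?_ (key.trans ?_)
  · rw [detW3, a0, a1, a2, b, b', c, c', d, d']
    congr 1
    ext i j
    fin_cases i <;> fin_cases j <;> apply Complex.ext <;> simp <;> ring
  · congr 1
    simp [Complex.normSq_apply]
    ring

/-- The determinant of the partial transpose of `{x, y, T}`. -/
lemma detW4_canonicalState (x y : Fin 3 → ℝ) (T : Matrix (Fin 3) (Fin 3) ℝ) :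
    detW4 (canonicalState x y T) = ((1 / 4 ^ 4 *
      ((1 - sqNorm x - sqNorm y - matSqNorm T) ^ 2 + 8 * (x ⬝ᵥ T *ᵥ y) + 8 * T.det
        - 4 * (sqNorm x * sqNorm y) - 4 * (sqNorm (Tᵀ *ᵥ x) + sqNorm (T *ᵥ y))
        - 4 * matSqNorm T.adjugate - 8 * (x ⬝ᵥ T.adjugateᵀ *ᵥ y)) : ℝ) : ℂ) := by
  obtain ⟨⟨a0, a1, a2, a3⟩, ⟨b, b'⟩, ⟨c, c'⟩, ⟨d, d'⟩, ⟨e, e'⟩, ⟨f, f'⟩, ⟨g, g'⟩⟩ :=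
    canonicalState_apply x y T
  have key := det_hermitian_four ((1 + x 2 + y 2 + T 2 2) / 4) ((1 + x 2 - y 2 - T 2 2) / 4)
    ((1 - x 2 + y 2 - T 2 2) / 4) ((1 - x 2 - y 2 + T 2 2) / 4)
    ⟨(y 0 + T 2 0) / 4, (y 1 + T 2 1) / 4⟩
    ⟨(x 0 + T 0 2) / 4, -(x 1 + T 1 2) / 4⟩ ⟨(T 0 0 + T 1 1) / 4, (T 0 1 - T 1 0) / 4⟩
    ⟨(T 0 0 - T 1 1) / 4, -(T 0 1 + T 1 0) / 4⟩ ⟨(x 0 - T 0 2) / 4, -(x 1 - T 1 2) / 4⟩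
    ⟨(y 0 - T 2 0) / 4, (y 1 - T 2 1) / 4⟩
  refine Eq.trans ?_ (key.trans ?_)
  · rw [detW4, a0, a1, a2, a3, b, b', c, c', d, d', e, e', f, f', g, g']
    congr 1
    ext i j
    fin_cases i <;> fin_cases j <;> apply Complex.ext <;> simp <;> ring
  · congr 1
    simp [Complex.normSq_apply, sqNorm, matSqNorm, dotProduct, mulVec, adjugate_fin_three,
      det_fin_three, Fin.sum_univ_three]
    ring

lemma detW2_canonicalState (x y : Fin 3 → ℝ) (T : Matrix (Fin 3) (Fin 3) ℝ) :
    detW2 (canonicalState x y T)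
      = ((1 / 4 ^ 2 * ((1 + x 2) ^ 2 - ∑ i, (y i + T 2 i) ^ 2) : ℝ) : ℂ) := by
  obtain ⟨⟨a0, a1, -⟩, ⟨b, b'⟩, -⟩ := canonicalState_apply x y T
  rw [detW2, a0, a1, b, b', det_fin_two]
  apply Complex.ext <;> simp [Fin.sum_univ_three, pow_two] <;> ring

lemma detW2_local (x y : Fin 3 → ℝ) (T : Matrix (Fin 3) (Fin 3) ℝ) :
    detW2 (canonicalState ((2 / 3 : ℝ) • x) ((2 / 3 : ℝ) • y) ((4 / 9 : ℝ) • T)) = W2l x y T := by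
  rw [detW2_canonicalState, W2l]
  congr 1
  simp [Fin.sum_univ_three]
  ring

lemma detW3_local (x y : Fin 3 → ℝ) (T : Matrix (Fin 3) (Fin 3) ℝ) :
    detW3 (canonicalState ((2 / 3 : ℝ) • x) ((2 / 3 : ℝ) • y) ((4 / 9 : ℝ) • T)) = W3l x y T := by
  rw [detW3_canonicalState, W3l]
  congr 1
  simp
  ring

lemma sqNorm_smul (c : ℝ) (v : Fin 3 → ℝ) : sqNorm (c • v) = c ^ 2 * sqNorm v := by
  simp [sqNorm, Fin.sum_univ_three]; ring

lemma matSqNorm_smul (c : ℝ) (T : Matrix (Fin 3) (Fin 3) ℝ) :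
    matSqNorm (c • T) = c ^ 2 * matSqNorm T := by
  simp [matSqNorm, Fin.sum_univ_three]; ring

lemma detW4_local (x y : Fin 3 → ℝ) (T : Matrix (Fin 3) (Fin 3) ℝ) :
    detW4 (canonicalState ((2 / 3 : ℝ) • x) ((2 / 3 : ℝ) • y) ((4 / 9 : ℝ) • T)) = W4l x y T := by
  rw [detW4_canonicalState, W4l]
  congr 1
  simp only [transpose_smul, mulVec_smul, smul_mulVec, smul_dotProduct, dotProduct_smul, det_smul,
    adjugate_smul, sqNorm_smul, matSqNorm_smul, Fintype.card_fin, smul_smul, smul_eq_mul]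
  ring

lemma detW2_nonlocal (x y : Fin 3 → ℝ) (T : Matrix (Fin 3) (Fin 3) ℝ) :
    detW2 (canonicalState ((3 / 5 : ℝ) • x) ((3 / 5 : ℝ) • y) ((3 / 5 : ℝ) • T))
      = W2nl x y T := by
  rw [detW2_canonicalState, W2nl]
  congr 1
  simp [Fin.sum_univ_three]
  ring

lemma detW3_nonlocal (x y : Fin 3 → ℝ) (T : Matrix (Fin 3) (Fin 3) ℝ) :
    detW3 (canonicalState ((3 / 5 : ℝ) • x) ((3 / 5 : ℝ) • y) ((3 / 5 : ℝ) • T))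
      = W3nl x y T := by
  rw [detW3_canonicalState, W3nl]
  congr 1
  simp
  ring

lemma detW4_nonlocal (x y : Fin 3 → ℝ) (T : Matrix (Fin 3) (Fin 3) ℝ) :
    detW4 (canonicalState ((3 / 5 : ℝ) • x) ((3 / 5 : ℝ) • y) ((3 / 5 : ℝ) • T))
      = W4nl x y T := by
  rw [detW4_canonicalState, W4nl]
  congr 1
  simp only [transpose_smul, mulVec_smul, smul_mulVec, smul_dotProduct, dotProduct_smul, det_smul,
    adjugate_smul, sqNorm_smul, matSqNorm_smul, Fintype.card_fin, smul_smul, smul_eq_mul]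
  ring

/-! ### States `{s x, s x, t 1}` -/

lemma trace_canonicalState (x y : Fin 3 → ℝ) (T : Matrix (Fin 3) (Fin 3) ℝ) :
    (canonicalState x y T).trace = 1 := by
  obtain ⟨⟨a0, a1, a2, a3⟩, -⟩ := canonicalState_apply x y T
  simp only [Matrix.trace, Fintype.sum_prod_type, Fin.sum_univ_two, diag_apply, a0, a1, a2, a3]
  apply Complex.ext <;> simp; ring

/-- With the unnormalised Bell vectors `B₀ = |00⟩ + |11⟩` and `Bᵢ = (σᵢ ⊗ 1) B₀`, the partial
transpose of `{s x, s x, t 1}` couples `B₀` only to `∑ xᵢ Bᵢ`, and completing squares gives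
`8 {s x, s x, t 1}^Γ = (1 - t) ∑ wᵢ wᵢ† + (1 + 3t - 4s²‖x‖/(1 - t)) B₀ B₀†` with
`wᵢ = Bᵢ + 2s/(1 - t) xᵢ B₀`. -/
lemma posSemidef_partialTranspose_symmetric {s t : ℝ} (ht : t < 1) (x : Fin 3 → ℝ)
    (h : 4 * s ^ 2 * sqNorm x ≤ (1 - t) * (1 + 3 * t)) :
    (partialTranspose (canonicalState (s • x) (s • x) (t • 1))).PosSemidef := by
  have h1t : (0 : ℝ) < 1 - t := by linarith
  set r : ℝ := 2 * s / (1 - t) with hr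
  set m : ℝ := 1 + 3 * t - 4 * s ^ 2 * sqNorm x / (1 - t) with hm
  have hm0 : 0 ≤ m := by
    rw [hm, sub_nonneg, div_le_iff₀ h1t]; linarith
  set B : TwoQubit → ℂ := fun p => if p.1 = p.2 then 1 else 0 with hB
  set w : Fin 3 → TwoQubit → ℂ := fun i p => pauli i p.1 p.2 + ((r * x i : ℝ) : ℂ) * B p with hw
  have key : partialTranspose (canonicalState (s • x) (s • x) (t • 1))
      = ((1 - t) / 8) • ∑ i, vecMulVec (w i) (star (w i)) + (m / 8) • vecMulVec B (star B) := by
    have hs : 2 * s = r * (1 - t) := by rw [hr]; field_simp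
    have hm' : m = 1 + 3 * t - r ^ 2 * (1 - t) * sqNorm x := by
      rw [hm, hr]; field_simp; ring
    have hs : s = r * (1 - t) / 2 := by linarith
    rw [hm', hs]
    clear_value r m
    obtain ⟨⟨a0, a1, a2, a3⟩, ⟨b, b'⟩, ⟨c, c'⟩, ⟨d, d'⟩, ⟨e, e'⟩, ⟨f, f'⟩, ⟨g, g'⟩⟩ :=
      canonicalState_apply ((r * (1 - t) / 2) • x) ((r * (1 - t) / 2) • x) (t • 1)
    ext ⟨i, j⟩ ⟨k, l⟩
    simp only [Matrix.add_apply, Matrix.smul_apply, vecMulVec_apply,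
      partialTranspose_apply, Fin.sum_univ_three, Pi.star_apply, hw, hB]
    fin_cases i <;> fin_cases j <;> fin_cases k <;> fin_cases l <;>
      simp only [Fin.zero_eta, Fin.mk_one, a0, a1, a2, a3, b, b', c, c', d, d', e, e', f, f', g,
        g'] <;>
      apply Complex.ext <;> simp [pauli, sqNorm, Fin.sum_univ_three, pow_two] <;> ring
  rw [key]
  refine (posSemidef_real_smul (by positivity) ?_).add
    (posSemidef_real_smul (by positivity) (posSemidef_vecMulVec_self_star _))
  exact posSemidef_sum _ fun i _ => posSemidef_vecMulVec_self_star _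

lemma det_partialTranspose_symmetric (s t : ℝ) (x : Fin 3 → ℝ) :
    (partialTranspose (canonicalState (s • x) (s • x) (t • 1))).det
      = (((1 - t) ^ 2 * ((1 - t) * (1 + 3 * t) - 4 * s ^ 2 * sqNorm x) / 4 ^ 4 : ℝ) : ℂ) := by
  rw [← detW4_eq, detW4_canonicalState]
  congr 1
  simp [sqNorm, matSqNorm, dotProduct, mulVec, adjugate_smul, Fin.sum_univ_three]
  ring

/-- The state `{s x, s x, t 1}` is separable if and only if `4s²‖x‖ ≤ (1 - t)(1 + 3t)`, the difference
of the two sides being a positive multiple of `det ρ^Γ`. -/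
theorem isSeparableState_symmetric_iff {s t : ℝ} (ht : t < 1) (x : Fin 3 → ℝ)
    (hpos : (canonicalState (s • x) (s • x) (t • 1)).PosSemidef) :
    IsSeparableState (canonicalState (s • x) (s • x) (t • 1))
      ↔ 4 * s ^ 2 * sqNorm x ≤ (1 - t) * (1 + 3 * t) := by
  rw [isSeparableState_iff_posSemidef_partialTranspose ⟨hpos, trace_canonicalState _ _ _⟩]
  refine ⟨fun h => ?_, posSemidef_partialTranspose_symmetric ht x⟩
  have h1 := h.det_nonneg
  rw [det_partialTranspose_symmetric] at h1
  have h2 : 0 ≤ (1 - t) ^ 2 * ((1 - t) * (1 + 3 * t) - 4 * s ^ 2 * sqNorm x) / 4 ^ 4 := by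
    exact_mod_cast h1
  have h3 : 0 < (1 - t) ^ 2 := pow_pos (by linarith) 2
  by_contra hlt
  push Not at hlt
  have : (1 - t) ^ 2 * ((1 - t) * (1 + 3 * t) - 4 * s ^ 2 * sqNorm x) < 0 :=
    mul_neg_of_pos_of_neg h3 (by linarith)
  linarith

/-! ### The Buzek-Hillery cloner -/

/-- The prescribed inner products force `Y_ji = X_ii`, the two being unit vectors of inner
product one. -/
lemma BHMachine.Y_eq_X {ι κ : Type*} [Fintype κ] (S : BHMachine ι κ) {i j : ι}
    (h : i ≠ j) : S.Y j i = S.X i := by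
  have h1 := S.inner_X_Y_swap i j h
  have h2 : inner ℂ (S.Y j i) (S.X i) = 1 := by
    rw [← inner_conj_symm, h1, map_one]
  have : inner ℂ (S.Y j i - S.X i) (S.Y j i - S.X i) = (0 : ℂ) := by
    rw [inner_sub_left, inner_sub_right, inner_sub_right, S.inner_Y_self j i h.symm, h1, h2,
      S.inner_X_self]
    ring
  exact sub_eq_zero.1 (inner_self_eq_zero.1 this)

/-- As `Y_ij = X_jj` and `c = 2d`, the cloner is `|i⟩ ↦ d ∑ⱼ (|i⟩|j⟩ + |j⟩|i⟩) |X_jj⟩`. -/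
lemma BHMachine.cloner_apply {ι κ : Type*} [Fintype ι] [DecidableEq ι] [Fintype κ]
    (S : BHMachine ι κ) (p q : ι) (a : κ) (i : ι) :
    S.cloner ((p, q), a) i = (Real.sqrt (1 / (2 * ((Fintype.card ι : ℝ) + 1))) : ℂ)
      * ((if p = i then S.X q a else 0) + (if q = i then S.X p a else 0)) := by
  have hc : Real.sqrt (2 / ((Fintype.card ι : ℝ) + 1))
      = 2 * Real.sqrt (1 / (2 * ((Fintype.card ι : ℝ) + 1))) := by
    rw [show (2 : ℝ) / ((Fintype.card ι : ℝ) + 1)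
      = 2 ^ 2 * (1 / (2 * ((Fintype.card ι : ℝ) + 1))) by field_simp,
      Real.sqrt_mul (by positivity), Real.sqrt_sq (by norm_num)]
  have hsum : ∑ j ∈ Finset.univ.filter (fun j => j ≠ i),
      ((if (p, q) = (i, j) then (1 : ℂ) else 0) + (if (p, q) = (j, i) then 1 else 0)) * S.Y i j a
      = ∑ j ∈ Finset.univ.filter (fun j => j ≠ i),
        ((if (p, q) = (i, j) then (1 : ℂ) else 0) + (if (p, q) = (j, i) then 1 else 0))
          * S.X j a :=
    Finset.sum_congr rfl fun j hj => by rw [S.Y_eq_X (Finset.mem_filter.1 hj).2]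
  simp only [BHMachine.cloner, Matrix.of_apply, hsum, hc]
  simp only [Finset.sum_filter, Prod.mk.injEq]
  by_cases hp : p = i <;> by_cases hq : q = i
  · subst hp; subst hq
    rw [Finset.sum_eq_zero fun j _ => by
      by_cases hj : j = q
      · simp [hj]
      · simp [hj, Ne.symm hj]]
    simp; ring
  · subst hp
    rw [Finset.sum_eq_single q (fun j _ hj => by simp [hq, hj.symm])
      (fun h => absurd (Finset.mem_univ q) h)]
    simp [hq]
  · subst hq
    rw [Finset.sum_eq_single p (fun j _ hj => by simp [hp, hj.symm])
      (fun h => absurd (Finset.mem_univ p) h)]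
    simp [hp]
  · simp [hp, hq]

/-- The Gram kernel of the cloner: the machine traced out of
`cloner |i⟩⟨k| cloner†`, in the entry `|p q⟩⟨p' q'|`. -/
lemma BHMachine.sum_cloner_mul_star {ι κ : Type*} [Fintype ι] [DecidableEq ι] [Fintype κ]
    (S : BHMachine ι κ) (p q p' q' i k : ι) :
    ∑ a, S.cloner ((p, q), a) i * star (S.cloner ((p', q'), a) k)
      = (1 / (2 * ((Fintype.card ι : ℂ) + 1))) *
        ((if p = i ∧ p' = k ∧ q = q' then 1 else 0) + (if p = i ∧ q' = k ∧ q = p' then 1 else 0)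
          + (if q = i ∧ p' = k ∧ p = q' then 1 else 0)
          + (if q = i ∧ q' = k ∧ p = p' then 1 else 0)) := by
  have horth : ∀ r s : ι, ∑ a, S.X r a * star (S.X s a) = if r = s then 1 else 0 := by
    intro r s
    have : ∑ a, S.X r a * star (S.X s a) = inner ℂ (S.X s) (S.X r) := by
      rw [PiLp.inner_apply]
      exact Finset.sum_congr rfl fun a _ => by simp
    rw [this]
    split_ifs with h
    · rw [h, S.inner_X_self]
    · exact S.inner_X_X s r (Ne.symm h)
  have hd : ((Real.sqrt (1 / (2 * ((Fintype.card ι : ℝ) + 1))) : ℝ) : ℂ)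
      * (Real.sqrt (1 / (2 * ((Fintype.card ι : ℝ) + 1))) : ℝ)
      = 1 / (2 * ((Fintype.card ι : ℂ) + 1)) := by
    rw [← Complex.ofReal_mul, Real.mul_self_sqrt (by positivity)]
    push_cast; rfl
  rw [← hd]
  set d : ℂ := ((Real.sqrt (1 / (2 * ((Fintype.card ι : ℝ) + 1))) : ℝ) : ℂ) with hd'
  have hds : star d = d := Complex.conj_ofReal _
  simp only [S.cloner_apply, ← hd', star_mul', hds]
  have : ∀ r s r' s' : ι, (if r = i ∧ r' = k ∧ s = s' then (1 : ℂ) else 0)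
      = ∑ a, (if r = i then S.X s a else 0) * star (if r' = k then S.X s' a else 0) := by
    intro r s r' s'
    by_cases h1 : r = i <;> by_cases h2 : r' = k <;> simp only [h1, h2, if_true, if_false, true_and,
      false_and, star_zero, zero_mul, mul_zero, Finset.sum_const_zero, horth]
  rw [this p q p' q', this p q q' p', this q p p' q', this q p q' p', ← Finset.sum_add_distrib,
    ← Finset.sum_add_distrib, ← Finset.sum_add_distrib, Finset.mul_sum]
  refine Finset.sum_congr rfl fun a _ => ?_
  rw [star_add]
  ring

/-- The output of local cloning in terms of the input and of the Gram kernels of the cloners. -/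
lemma localOutput_apply {κA κB : Type*} [Fintype κA] [Fintype κB]
    (A : BHMachine (Fin 2) κA) (B : BHMachine (Fin 2) κB) (ρ : Matrix TwoQubit TwoQubit ℂ)
    (q₁ q₂ q₃ q₄ r₁ r₂ r₃ r₄ : Fin 2) :
    localOutput A B ρ (q₁, q₂, q₃, q₄) (r₁, r₂, r₃, r₄)
      = ∑ u : TwoQubit, ∑ v : TwoQubit, ρ v u
        * (∑ a, A.cloner ((q₁, q₃), a) v.1 * star (A.cloner ((r₁, r₃), a) u.1))
        * (∑ b, B.cloner ((q₂, q₄), b) v.2 * star (B.cloner ((r₂, r₄), b) u.2)) := by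
  simp only [localOutput, Matrix.of_apply, Matrix.mul_apply, conjTranspose_apply,
    kroneckerMap_apply, Finset.sum_mul, Finset.mul_sum]
  rw [Finset.sum_congr rfl fun a _ => Finset.sum_comm, Finset.sum_comm]
  refine Finset.sum_congr rfl fun u _ => ?_
  rw [Finset.sum_congr rfl fun a _ => Finset.sum_comm, Finset.sum_comm]
  refine Finset.sum_congr rfl fun v _ => ?_
  rw [Finset.sum_comm]
  refine Finset.sum_congr rfl fun b _ => Finset.sum_congr rfl fun a _ => ?_
  rw [star_mul']
  ring

/-- The output of nonlocal cloning in terms of the input and of the Gram kernel of the cloner. -/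
lemma nonlocalOutput_apply {κ : Type*} [Fintype κ] (N : BHMachine TwoQubit κ)
    (ρ : Matrix TwoQubit TwoQubit ℂ) (q₁ q₂ q₃ q₄ r₁ r₂ r₃ r₄ : Fin 2) :
    nonlocalOutput N ρ (q₁, q₂, q₃, q₄) (r₁, r₂, r₃, r₄)
      = ∑ u : TwoQubit, ∑ v : TwoQubit, ρ v u
        * (∑ m, N.cloner (((q₁, q₂), (q₃, q₄)), m) v
          * star (N.cloner (((r₁, r₂), (r₃, r₄)), m) u)) := by
  simp only [nonlocalOutput, Matrix.of_apply, Matrix.mul_apply, conjTranspose_apply,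
    Finset.sum_mul, Finset.mul_sum]
  rw [Finset.sum_comm]
  refine Finset.sum_congr rfl fun u _ => ?_
  rw [Finset.sum_comm]
  refine Finset.sum_congr rfl fun v _ => Finset.sum_congr rfl fun m _ => ?_
  ring

lemma posSemidef_localOutput {κA κB : Type*} [Fintype κA] [Fintype κB]
    (A : BHMachine (Fin 2) κA) (B : BHMachine (Fin 2) κB) {ρ : Matrix TwoQubit TwoQubit ℂ}
    (hρ : ρ.PosSemidef) : (localOutput A B ρ).PosSemidef := by
  have : localOutput A B ρ = ∑ a : κA, ∑ b : κB,
      ((A.cloner ⊗ₖ B.cloner) * ρ * (A.cloner ⊗ₖ B.cloner)ᴴ).submatrix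
        (fun q : FourQubit => (((q.1, q.2.2.1), a), ((q.2.1, q.2.2.2), b)))
        (fun q : FourQubit => (((q.1, q.2.2.1), a), ((q.2.1, q.2.2.2), b))) := by
    ext q r
    simp only [Matrix.sum_apply, submatrix_apply]
    rfl
  rw [this]
  exact posSemidef_sum _ fun a _ => posSemidef_sum _ fun b _ =>
    (hρ.mul_mul_conjTranspose_same _).submatrix _

lemma posSemidef_nonlocalOutput {κ : Type*} [Fintype κ] (N : BHMachine TwoQubit κ)
    {ρ : Matrix TwoQubit TwoQubit ℂ} (hρ : ρ.PosSemidef) : (nonlocalOutput N ρ).PosSemidef := by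
  have : nonlocalOutput N ρ = ∑ m : κ, (N.cloner * ρ * N.clonerᴴ).submatrix
        (fun q : FourQubit => (((q.1, q.2.1), (q.2.2.1, q.2.2.2)), m))
        (fun q : FourQubit => (((q.1, q.2.1), (q.2.2.1, q.2.2.2)), m)) := by
    ext q r
    simp only [Matrix.sum_apply, submatrix_apply]
    rfl
  rw [this]
  exact posSemidef_sum _ fun m _ => (hρ.mul_mul_conjTranspose_same _).submatrix _

lemma posSemidef_marginal13 {R : Matrix FourQubit FourQubit ℂ} (hR : R.PosSemidef) :
    (marginal13 R).PosSemidef := by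
  have : marginal13 R = ∑ s₂, ∑ s₄, R.submatrix (fun q : TwoQubit => (q.1, s₂, q.2, s₄))
      (fun q : TwoQubit => (q.1, s₂, q.2, s₄)) := by
    ext q r
    simp only [Matrix.sum_apply, submatrix_apply]
    rfl
  rw [this]
  exact posSemidef_sum _ fun _ _ => posSemidef_sum _ fun _ _ => hR.submatrix _

lemma posSemidef_marginal24 {R : Matrix FourQubit FourQubit ℂ} (hR : R.PosSemidef) :
    (marginal24 R).PosSemidef := by
  have : marginal24 R = ∑ s₁, ∑ s₃, R.submatrix (fun q : TwoQubit => (s₁, q.1, s₃, q.2))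
      (fun q : TwoQubit => (s₁, q.1, s₃, q.2)) := by
    ext q r
    simp only [Matrix.sum_apply, submatrix_apply]
    rfl
  rw [this]
  exact posSemidef_sum _ fun _ _ => posSemidef_sum _ fun _ _ => hR.submatrix _

/-! ### Marginals of the outputs -/

/-- The second copy traced out: in dimension `M` the first copy carries
`((M + 2) ρ + tr ρ) / (2 (M + 1))`. -/
lemma BHMachine.sum_snd_cloner_mul_star {ι κ : Type*} [Fintype ι] [DecidableEq ι] [Fintype κ]
    (S : BHMachine ι κ) (p p' i k : ι) :
    ∑ q, ∑ a, S.cloner ((p, q), a) i * star (S.cloner ((p', q), a) k)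
      = (1 / (2 * ((Fintype.card ι : ℂ) + 1))) *
        (((Fintype.card ι : ℂ) + 2) * (if p = i ∧ p' = k then 1 else 0)
          + (if i = k ∧ p = p' then 1 else 0)) := by
  simp only [S.sum_cloner_mul_star, ← Finset.mul_sum, Finset.sum_add_distrib]
  congr 1
  have h1 : ∑ _q : ι, (if p = i ∧ p' = k ∧ True then (1 : ℂ) else 0)
      = (Fintype.card ι : ℂ) * (if p = i ∧ p' = k then 1 else 0) := by
    simp [Finset.card_univ]
  have h2 : ∑ q : ι, (if p = i ∧ q = k ∧ q = p' then (1 : ℂ) else 0)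
      = if p = i ∧ p' = k then 1 else 0 := by
    rw [Finset.sum_eq_single p' (fun q _ hq => by simp [hq]) (by simp)]
    simp
  have h3 : ∑ q : ι, (if q = i ∧ p' = k ∧ p = q then (1 : ℂ) else 0)
      = if p = i ∧ p' = k then 1 else 0 := by
    rw [Finset.sum_eq_single p (fun q _ hq => by simp [hq.symm]) (by simp)]
    simp
  have h4 : ∑ q : ι, (if q = i ∧ q = k ∧ p = p' then (1 : ℂ) else 0)
      = if i = k ∧ p = p' then 1 else 0 := by
    rw [Finset.sum_eq_single i (fun q _ hq => by simp [hq]) (by simp)]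
    simp
  rw [h1, h2, h3, h4]
  ring

/-- The two copies are interchangeable. -/
lemma BHMachine.cloner_swap {ι κ : Type*} [Fintype ι] [DecidableEq ι] [Fintype κ]
    (S : BHMachine ι κ) (p q : ι) (a : κ) (i : ι) :
    S.cloner ((p, q), a) i = S.cloner ((q, p), a) i := by
  rw [S.cloner_apply, S.cloner_apply, add_comm (ite _ _ _)]

lemma BHMachine.sum_fst_cloner_mul_star {ι κ : Type*} [Fintype ι] [DecidableEq ι] [Fintype κ]
    (S : BHMachine ι κ) (q q' i k : ι) :
    ∑ p, ∑ a, S.cloner ((p, q), a) i * star (S.cloner ((p, q'), a) k)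
      = (1 / (2 * ((Fintype.card ι : ℂ) + 1))) *
        (((Fintype.card ι : ℂ) + 2) * (if q = i ∧ q' = k then 1 else 0)
          + (if i = k ∧ q = q' then 1 else 0)) := by
  rw [← S.sum_snd_cloner_mul_star]
  simp only [S.cloner_swap _ q, S.cloner_swap _ q']

/-- Both copies and the machine traced out: the cloner is an isometry. -/
lemma BHMachine.sum_sum_cloner_mul_star {ι κ : Type*} [Fintype ι] [DecidableEq ι] [Fintype κ]
    (S : BHMachine ι κ) (i k : ι) :
    ∑ p, ∑ q, ∑ a, S.cloner ((p, q), a) i * star (S.cloner ((p, q), a) k)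
      = if i = k then 1 else 0 := by
  simp only [S.sum_snd_cloner_mul_star, ← Finset.mul_sum, Finset.sum_add_distrib]
  have h1 : ∑ p : ι, (if p = i ∧ p = k then (1 : ℂ) else 0) = if i = k then 1 else 0 := by
    rw [Finset.sum_eq_single i (fun q _ hq => by simp [hq]) (by simp)]
    simp
  have h2 : ∑ _p : ι, (if i = k ∧ True then (1 : ℂ) else 0)
      = (Fintype.card ι : ℂ) * if i = k then 1 else 0 := by
    simp [Finset.card_univ]
  rw [h1, h2]
  have : (Fintype.card ι : ℂ) + 1 ≠ 0 := by
    exact_mod_cast Nat.succ_ne_zero (Fintype.card ι)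
  field_simp
  ring

/-- The reduced operator of the first qubit. -/
def reducedFirst (ρ : Matrix TwoQubit TwoQubit ℂ) : Matrix (Fin 2) (Fin 2) ℂ :=
  Matrix.of fun m n => ∑ s, ρ (m, s) (n, s)

/-- The reduced operator of the second qubit. -/
def reducedSecond (ρ : Matrix TwoQubit TwoQubit ℂ) : Matrix (Fin 2) (Fin 2) ℂ :=
  Matrix.of fun m n => ∑ s, ρ (s, m) (s, n)

lemma posSemidef_reducedFirst {ρ : Matrix TwoQubit TwoQubit ℂ} (h : ρ.PosSemidef) :
    (reducedFirst ρ).PosSemidef := by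
  have : reducedFirst ρ = ∑ s, ρ.submatrix (fun m => (m, s)) (fun m => (m, s)) := by
    ext m n
    simp only [Matrix.sum_apply, submatrix_apply]
    rfl
  rw [this]
  exact posSemidef_sum _ fun _ _ => h.submatrix _

lemma posSemidef_reducedSecond {ρ : Matrix TwoQubit TwoQubit ℂ} (h : ρ.PosSemidef) :
    (reducedSecond ρ).PosSemidef := by
  have : reducedSecond ρ = ∑ s, ρ.submatrix (fun m => (s, m)) (fun m => (s, m)) := by
    ext m n
    simp only [Matrix.sum_apply, submatrix_apply]
    rfl
  rw [this]
  exact posSemidef_sum _ fun _ _ => h.submatrix _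

/-- Both qubits sent through the channel `α ↦ (2/3) α + (1/6) tr α`. -/
noncomputable def localShrink (ρ : Matrix TwoQubit TwoQubit ℂ) : Matrix TwoQubit TwoQubit ℂ :=
  (4 / 9 : ℝ) • ρ + (1 / 9 : ℝ) • (reducedFirst ρ ⊗ₖ 1) + (1 / 9 : ℝ) • (1 ⊗ₖ reducedSecond ρ)
    + (1 / 36 : ℝ) • (ρ.trace • (1 : Matrix TwoQubit TwoQubit ℂ))

/-- The product of two one-copy kernels acts as `localShrink`. -/
lemma sum_shrink_eq_localShrink (ρ : Matrix TwoQubit TwoQubit ℂ) (m μ n ν : Fin 2) :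
    ∑ u : TwoQubit, ∑ v : TwoQubit, ρ v u
      * ((1 / 6 : ℂ) * (4 * (if m = v.1 ∧ n = u.1 then 1 else 0)
          + (if v.1 = u.1 ∧ m = n then 1 else 0)))
      * ((1 / 6 : ℂ) * (4 * (if μ = v.2 ∧ ν = u.2 then 1 else 0)
          + (if v.2 = u.2 ∧ μ = ν then 1 else 0)))
      = localShrink ρ (m, μ) (n, ν) := by
  simp only [localShrink, Matrix.add_apply, Matrix.smul_apply, kroneckerMap_apply, reducedFirst,
    reducedSecond, Matrix.of_apply, Matrix.trace, diag_apply, Fintype.sum_prod_type,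
    Fin.sum_univ_two, Matrix.one_apply, Complex.real_smul, smul_eq_mul, Prod.mk.injEq]
  fin_cases m <;> fin_cases μ <;> fin_cases n <;> fin_cases ν <;> simp <;> ring

lemma sum_mul_mul_comm {α β γ : Type*} [Fintype α] [Fintype β] [Fintype γ] (c : γ → γ → ℂ)
    (f : β → γ → γ → ℂ) (g : α → γ → γ → ℂ) :
    ∑ s, ∑ t, ∑ u, ∑ v, c v u * f t v u * g s v u
      = ∑ u, ∑ v, c v u * (∑ t, f t v u) * ∑ s, g s v u := by
  simp only [Finset.mul_sum, Finset.sum_mul]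
  rw [Finset.sum_congr rfl fun s _ => Finset.sum_comm, Finset.sum_comm]
  refine Finset.sum_congr rfl fun u _ => ?_
  rw [Finset.sum_congr rfl fun s _ => Finset.sum_comm, Finset.sum_comm]

lemma marginal14_localOutput {κA κB : Type*} [Fintype κA] [Fintype κB]
    (A : BHMachine (Fin 2) κA) (B : BHMachine (Fin 2) κB) (ρ : Matrix TwoQubit TwoQubit ℂ) :
    marginal14 (localOutput A B ρ) = localShrink ρ := by
  ext ⟨m, μ⟩ ⟨n, ν⟩
  rw [← sum_shrink_eq_localShrink]
  simp only [marginal14, Matrix.of_apply, localOutput_apply]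
  refine (sum_mul_mul_comm ρ
    (fun t v u => ∑ a, A.cloner ((m, t), a) v.1 * star (A.cloner ((n, t), a) u.1))
    (fun s v u => ∑ b, B.cloner ((s, μ), b) v.2 * star (B.cloner ((s, ν), b) u.2))).trans ?_
  simp only [A.sum_snd_cloner_mul_star, B.sum_fst_cloner_mul_star, Fintype.card_fin]
  norm_num

lemma marginal32_localOutput {κA κB : Type*} [Fintype κA] [Fintype κB]
    (A : BHMachine (Fin 2) κA) (B : BHMachine (Fin 2) κB) (ρ : Matrix TwoQubit TwoQubit ℂ) :
    marginal32 (localOutput A B ρ) = localShrink ρ := by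
  ext ⟨m, μ⟩ ⟨n, ν⟩
  rw [← sum_shrink_eq_localShrink]
  simp only [marginal32, Matrix.of_apply, localOutput_apply]
  rw [Finset.sum_comm]
  refine (sum_mul_mul_comm ρ
    (fun t v u => ∑ a, A.cloner ((t, m), a) v.1 * star (A.cloner ((t, n), a) u.1))
    (fun s v u => ∑ b, B.cloner ((μ, s), b) v.2 * star (B.cloner ((ν, s), b) u.2))).trans ?_
  simp only [A.sum_fst_cloner_mul_star, B.sum_snd_cloner_mul_star, Fintype.card_fin]
  norm_num

lemma sum_mul_comm_left {α β γ : Type*} [Fintype α] [Fintype β] [Fintype γ] (c d : γ → γ → ℂ)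
    (g : α → β → γ → γ → ℂ) :
    ∑ s, ∑ t, ∑ u, ∑ v, c v u * g s t v u * d v u
      = ∑ u, ∑ v, c v u * (∑ s, ∑ t, g s t v u) * d v u := by
  simp only [Finset.mul_sum, Finset.sum_mul]
  rw [Finset.sum_congr rfl fun s _ => Finset.sum_comm, Finset.sum_comm]
  refine Finset.sum_congr rfl fun u _ => ?_
  rw [Finset.sum_congr rfl fun s _ => Finset.sum_comm, Finset.sum_comm]

lemma sum_mul_comm_right {α β γ : Type*} [Fintype α] [Fintype β] [Fintype γ] (c : γ → γ → ℂ)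
    (g : α → β → γ → γ → ℂ) :
    ∑ s, ∑ t, ∑ u, ∑ v, c v u * g s t v u = ∑ u, ∑ v, c v u * ∑ s, ∑ t, g s t v u := by
  simpa using sum_mul_comm_left c (fun _ _ => 1) g

/-- The symmetrisation `S (α ⊗ 1) S` with `S = 1 + swap`. Up to a factor it is the joint state of
the two copies of `α`. -/
def symmetrized (α : Matrix (Fin 2) (Fin 2) ℂ) : Matrix TwoQubit TwoQubit ℂ :=
  Matrix.of fun q r => (if q.2 = r.2 then α q.1 r.1 else 0) + (if q.2 = r.1 then α q.1 r.2 else 0)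
    + (if q.1 = r.2 then α q.2 r.1 else 0) + (if q.1 = r.1 then α q.2 r.2 else 0)

lemma marginal13_localOutput {κA κB : Type*} [Fintype κA] [Fintype κB]
    (A : BHMachine (Fin 2) κA) (B : BHMachine (Fin 2) κB) (ρ : Matrix TwoQubit TwoQubit ℂ) :
    marginal13 (localOutput A B ρ) = (1 / 6 : ℝ) • symmetrized (reducedFirst ρ) := by
  ext ⟨p, q⟩ ⟨p', q'⟩
  simp only [marginal13, Matrix.of_apply, localOutput_apply]
  refine (sum_mul_comm_right
    (fun v u => ρ v u * ∑ a, A.cloner ((p, q), a) v.1 * star (A.cloner ((p', q'), a) u.1))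
    (fun s t v u => ∑ b, B.cloner ((s, t), b) v.2 * star (B.cloner ((s, t), b) u.2))).trans ?_
  simp only [A.sum_cloner_mul_star, B.sum_sum_cloner_mul_star, Fintype.card_fin]
  simp only [Fintype.sum_prod_type, Fin.sum_univ_two, symmetrized, reducedFirst, Matrix.of_apply,
    Matrix.smul_apply, Complex.real_smul]
  fin_cases p <;> fin_cases q <;> fin_cases p' <;> fin_cases q' <;> simp <;> ring

lemma marginal24_localOutput {κA κB : Type*} [Fintype κA] [Fintype κB]
    (A : BHMachine (Fin 2) κA) (B : BHMachine (Fin 2) κB) (ρ : Matrix TwoQubit TwoQubit ℂ) :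
    marginal24 (localOutput A B ρ) = (1 / 6 : ℝ) • symmetrized (reducedSecond ρ) := by
  ext ⟨p, q⟩ ⟨p', q'⟩
  simp only [marginal24, Matrix.of_apply, localOutput_apply]
  refine (sum_mul_comm_left ρ
    (fun v u => ∑ b, B.cloner ((p, q), b) v.2 * star (B.cloner ((p', q'), b) u.2))
    (fun s t v u => ∑ a, A.cloner ((s, t), a) v.1 * star (A.cloner ((s, t), a) u.1))).trans ?_
  simp only [B.sum_cloner_mul_star, A.sum_sum_cloner_mul_star, Fintype.card_fin]
  simp only [Fintype.sum_prod_type, Fin.sum_univ_two, symmetrized, reducedSecond, Matrix.of_apply,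
    Matrix.smul_apply, Complex.real_smul]
  fin_cases p <;> fin_cases q <;> fin_cases p' <;> fin_cases q' <;> simp <;> ring

/-- The mixture of `ρ` with white noise, in proportion `3 : 2` for states. -/
noncomputable def nonlocalShrink (ρ : Matrix TwoQubit TwoQubit ℂ) : Matrix TwoQubit TwoQubit ℂ :=
  (3 / 5 : ℝ) • ρ + (1 / 10 : ℝ) • (ρ.trace • (1 : Matrix TwoQubit TwoQubit ℂ))

lemma sum_shrink_eq_nonlocalShrink (ρ : Matrix TwoQubit TwoQubit ℂ) (q r : TwoQubit) :
    ∑ u : TwoQubit, ∑ v : TwoQubit, ρ v u * ((1 / 10 : ℂ) * (6 * (if q = v ∧ r = u then 1 else 0)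
          + (if v = u ∧ q = r then 1 else 0))) = nonlocalShrink ρ q r := by
  simp only [nonlocalShrink, Matrix.add_apply, Matrix.smul_apply, Matrix.trace, diag_apply,
    Matrix.one_apply, Complex.real_smul, smul_eq_mul]
  have h1 : ∑ u : TwoQubit, ∑ v : TwoQubit, ρ v u * (if q = v ∧ r = u then 1 else 0) = ρ q r := by
    rw [Finset.sum_eq_single r (fun u _ hu => by simp [hu.symm]) (by simp),
      Finset.sum_eq_single q (fun u _ hu => by simp [hu.symm]) (by simp)]
    simp
  have h2 : ∑ u : TwoQubit, ∑ v : TwoQubit, ρ v u * (if v = u ∧ q = r then 1 else 0)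
      = (∑ u, ρ u u) * if q = r then 1 else 0 := by
    rw [Finset.sum_mul]
    refine Finset.sum_congr rfl fun u _ => ?_
    rw [Finset.sum_eq_single u (fun v _ hv => by simp [hv]) (by simp)]
    simp
  rw [← h1, ← h2, Finset.mul_sum, Finset.mul_sum, ← Finset.sum_add_distrib]
  refine Finset.sum_congr rfl fun u _ => ?_
  rw [Finset.mul_sum, Finset.mul_sum, ← Finset.sum_add_distrib]
  refine Finset.sum_congr rfl fun v _ => ?_
  push_cast
  ring

lemma marginal12_nonlocalOutput {κ : Type*} [Fintype κ] (N : BHMachine TwoQubit κ)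
    (ρ : Matrix TwoQubit TwoQubit ℂ) : marginal12 (nonlocalOutput N ρ) = nonlocalShrink ρ := by
  ext ⟨m, μ⟩ ⟨n, ν⟩
  rw [← sum_shrink_eq_nonlocalShrink]
  simp only [marginal12, Matrix.of_apply, nonlocalOutput_apply]
  refine (sum_mul_comm_right ρ (fun s t v u => ∑ a, N.cloner (((m, μ), (s, t)), a) v
    * star (N.cloner (((n, ν), (s, t)), a) u))).trans ?_
  refine Finset.sum_congr rfl fun u _ => Finset.sum_congr rfl fun v _ => ?_
  rw [← Fintype.sum_prod_type' (fun s t => ∑ a, N.cloner (((m, μ), (s, t)), a) v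
    * star (N.cloner (((n, ν), (s, t)), a) u)), N.sum_snd_cloner_mul_star]
  norm_num

lemma marginal34_nonlocalOutput {κ : Type*} [Fintype κ] (N : BHMachine TwoQubit κ)
    (ρ : Matrix TwoQubit TwoQubit ℂ) : marginal34 (nonlocalOutput N ρ) = nonlocalShrink ρ := by
  ext ⟨m, μ⟩ ⟨n, ν⟩
  rw [← sum_shrink_eq_nonlocalShrink]
  simp only [marginal34, Matrix.of_apply, nonlocalOutput_apply]
  refine (sum_mul_comm_right ρ (fun s t v u => ∑ a, N.cloner (((s, t), (m, μ)), a) v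
    * star (N.cloner (((s, t), (n, ν)), a) u))).trans ?_
  refine Finset.sum_congr rfl fun u _ => Finset.sum_congr rfl fun v _ => ?_
  rw [← Fintype.sum_prod_type' (fun s t => ∑ a, N.cloner (((s, t), (m, μ)), a) v
    * star (N.cloner (((s, t), (n, ν)), a) u)), N.sum_fst_cloner_mul_star]
  norm_num

lemma marginal13_nonlocalOutput {κ : Type*} [Fintype κ] (N : BHMachine TwoQubit κ)
    (ρ : Matrix TwoQubit TwoQubit ℂ) : marginal13 (nonlocalOutput N ρ)
      = (1 / 10 : ℝ) • (symmetrized (reducedFirst ρ) + reducedFirst ρ ⊗ₖ 1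
        + 1 ⊗ₖ reducedFirst ρ) := by
  ext ⟨p, q⟩ ⟨p', q'⟩
  simp only [marginal13, Matrix.of_apply, nonlocalOutput_apply]
  refine (sum_mul_comm_right ρ (fun s t v u => ∑ a, N.cloner (((p, s), (q, t)), a) v
    * star (N.cloner (((p', s), (q', t)), a) u))).trans ?_
  simp only [N.sum_cloner_mul_star, Fintype.card_prod, Fintype.card_fin]
  simp only [Fintype.sum_prod_type, Fin.sum_univ_two, symmetrized, reducedFirst, Matrix.of_apply,
    Matrix.smul_apply, Matrix.add_apply, kroneckerMap_apply, Matrix.one_apply, Complex.real_smul,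
    Prod.mk.injEq]
  fin_cases p <;> fin_cases q <;> fin_cases p' <;> fin_cases q' <;> simp <;> ring

lemma marginal24_nonlocalOutput {κ : Type*} [Fintype κ] (N : BHMachine TwoQubit κ)
    (ρ : Matrix TwoQubit TwoQubit ℂ) : marginal24 (nonlocalOutput N ρ)
      = (1 / 10 : ℝ) • (symmetrized (reducedSecond ρ) + reducedSecond ρ ⊗ₖ 1
        + 1 ⊗ₖ reducedSecond ρ) := by
  ext ⟨p, q⟩ ⟨p', q'⟩
  simp only [marginal24, Matrix.of_apply, nonlocalOutput_apply]
  refine (sum_mul_comm_right ρ (fun s t v u => ∑ a, N.cloner (((s, p), (t, q)), a) v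
    * star (N.cloner (((s, p'), (t, q')), a) u))).trans ?_
  simp only [N.sum_cloner_mul_star, Fintype.card_prod, Fintype.card_fin]
  simp only [Fintype.sum_prod_type, Fin.sum_univ_two, symmetrized, reducedSecond, Matrix.of_apply,
    Matrix.smul_apply, Matrix.add_apply, kroneckerMap_apply, Matrix.one_apply, Complex.real_smul,
    Prod.mk.injEq]
  fin_cases p <;> fin_cases q <;> fin_cases p' <;> fin_cases q' <;> simp <;> ring

/-! ### The outputs in Bloch form -/

/-- The one-qubit operator `(1 + x · σ) / 2`. -/
noncomputable def qubitState (x : Fin 3 → ℝ) : Matrix (Fin 2) (Fin 2) ℂ :=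
  !![⟨(1 + x 2) / 2, 0⟩, ⟨x 0 / 2, -x 1 / 2⟩; ⟨x 0 / 2, x 1 / 2⟩, ⟨(1 - x 2) / 2, 0⟩]

lemma reducedFirst_canonicalState (x y : Fin 3 → ℝ) (T : Matrix (Fin 3) (Fin 3) ℝ) :
    reducedFirst (canonicalState x y T) = qubitState x := by
  obtain ⟨⟨a0, a1, a2, a3⟩, ⟨b, b'⟩, ⟨c, c'⟩, ⟨d, d'⟩, ⟨e, e'⟩, ⟨f, f'⟩, ⟨g, g'⟩⟩ :=
    canonicalState_apply x y T
  ext i j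
  fin_cases i <;> fin_cases j <;>
    simp only [reducedFirst, qubitState, Matrix.of_apply, Fin.sum_univ_two, Fin.zero_eta,
      Fin.mk_one, a0, a1, a2, a3, c, c', f, f'] <;>
    apply Complex.ext <;> simp <;> ring

lemma reducedSecond_canonicalState (x y : Fin 3 → ℝ) (T : Matrix (Fin 3) (Fin 3) ℝ) :
    reducedSecond (canonicalState x y T) = qubitState y := by
  obtain ⟨⟨a0, a1, a2, a3⟩, ⟨b, b'⟩, ⟨c, c'⟩, ⟨d, d'⟩, ⟨e, e'⟩, ⟨f, f'⟩, ⟨g, g'⟩⟩ :=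
    canonicalState_apply x y T
  ext i j
  fin_cases i <;> fin_cases j <;>
    simp only [reducedSecond, qubitState, Matrix.of_apply, Fin.sum_univ_two, Fin.zero_eta,
      Fin.mk_one, a0, a1, a2, a3, b, b', g, g'] <;>
    apply Complex.ext <;> simp <;> ring

lemma symmetrized_qubitState (x : Fin 3 → ℝ) : (1 / 6 : ℝ) • symmetrized (qubitState x)
    = canonicalState ((2 / 3 : ℝ) • x) ((2 / 3 : ℝ) • x) ((1 / 3 : ℝ) • 1) := by
  obtain ⟨⟨a0, a1, a2, a3⟩, ⟨b, b'⟩, ⟨c, c'⟩, ⟨d, d'⟩, ⟨e, e'⟩, ⟨f, f'⟩, ⟨g, g'⟩⟩ :=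
    canonicalState_apply ((2 / 3 : ℝ) • x) ((2 / 3 : ℝ) • x) ((1 / 3 : ℝ) • 1)
  ext ⟨i, j⟩ ⟨k, l⟩
  fin_cases i <;> fin_cases j <;> fin_cases k <;> fin_cases l <;>
    simp only [Fin.zero_eta, Fin.mk_one, a0, a1, a2, a3, b, b', c, c', d, d', e, e', f, f', g,
      g', Matrix.smul_apply, symmetrized, Matrix.of_apply, qubitState] <;>
    apply Complex.ext <;> simp <;> ring

lemma symmetrized_add_noise_qubitState (x : Fin 3 → ℝ) :
    (1 / 10 : ℝ) • (symmetrized (qubitState x) + qubitState x ⊗ₖ 1 + 1 ⊗ₖ qubitState x)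
    = canonicalState ((3 / 5 : ℝ) • x) ((3 / 5 : ℝ) • x) ((1 / 5 : ℝ) • 1) := by
  obtain ⟨⟨a0, a1, a2, a3⟩, ⟨b, b'⟩, ⟨c, c'⟩, ⟨d, d'⟩, ⟨e, e'⟩, ⟨f, f'⟩, ⟨g, g'⟩⟩ :=
    canonicalState_apply ((3 / 5 : ℝ) • x) ((3 / 5 : ℝ) • x) ((1 / 5 : ℝ) • 1)
  ext ⟨i, j⟩ ⟨k, l⟩
  fin_cases i <;> fin_cases j <;> fin_cases k <;> fin_cases l <;>
    simp only [Fin.zero_eta, Fin.mk_one, a0, a1, a2, a3, b, b', c, c', d, d', e, e', f, f', g,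
      g', Matrix.smul_apply, Matrix.add_apply, kroneckerMap_apply, symmetrized, Matrix.of_apply,
      qubitState, Matrix.one_apply] <;>
    apply Complex.ext <;> simp <;> ring

lemma localShrink_canonicalState (x y : Fin 3 → ℝ) (T : Matrix (Fin 3) (Fin 3) ℝ) :
    localShrink (canonicalState x y T)
      = canonicalState ((2 / 3 : ℝ) • x) ((2 / 3 : ℝ) • y) ((4 / 9 : ℝ) • T) := by
  rw [localShrink, reducedFirst_canonicalState, reducedSecond_canonicalState, trace_canonicalState]
  obtain ⟨⟨a0, a1, a2, a3⟩, ⟨b, b'⟩, ⟨c, c'⟩, ⟨d, d'⟩, ⟨e, e'⟩, ⟨f, f'⟩, ⟨g, g'⟩⟩ :=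
    canonicalState_apply ((2 / 3 : ℝ) • x) ((2 / 3 : ℝ) • y) ((4 / 9 : ℝ) • T)
  obtain ⟨⟨A0, A1, A2, A3⟩, ⟨B, B'⟩, ⟨C, C'⟩, ⟨D, D'⟩, ⟨E, E'⟩, ⟨F, F'⟩, ⟨G, G'⟩⟩ :=
    canonicalState_apply x y T
  ext ⟨i, j⟩ ⟨k, l⟩
  fin_cases i <;> fin_cases j <;> fin_cases k <;> fin_cases l <;>
    simp only [Fin.zero_eta, Fin.mk_one, a0, a1, a2, a3, b, b', c, c', d, d', e, e', f, f', g,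
      g', A0, A1, A2, A3, B, B', C, C', D, D', E, E', F, F', G, G', Matrix.smul_apply,
      Matrix.add_apply, kroneckerMap_apply, qubitState, Matrix.one_apply] <;>
    apply Complex.ext <;> simp <;> ring

lemma nonlocalShrink_canonicalState (x y : Fin 3 → ℝ) (T : Matrix (Fin 3) (Fin 3) ℝ) :
    nonlocalShrink (canonicalState x y T)
      = canonicalState ((3 / 5 : ℝ) • x) ((3 / 5 : ℝ) • y) ((3 / 5 : ℝ) • T) := by
  rw [nonlocalShrink, trace_canonicalState]
  obtain ⟨⟨a0, a1, a2, a3⟩, ⟨b, b'⟩, ⟨c, c'⟩, ⟨d, d'⟩, ⟨e, e'⟩, ⟨f, f'⟩, ⟨g, g'⟩⟩ :=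
    canonicalState_apply ((3 / 5 : ℝ) • x) ((3 / 5 : ℝ) • y) ((3 / 5 : ℝ) • T)
  obtain ⟨⟨A0, A1, A2, A3⟩, ⟨B, B'⟩, ⟨C, C'⟩, ⟨D, D'⟩, ⟨E, E'⟩, ⟨F, F'⟩, ⟨G, G'⟩⟩ :=
    canonicalState_apply x y T
  ext ⟨i, j⟩ ⟨k, l⟩
  fin_cases i <;> fin_cases j <;> fin_cases k <;> fin_cases l <;>
    simp only [Fin.zero_eta, Fin.mk_one, a0, a1, a2, a3, b, b', c, c', d, d', e, e', f, f', g,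
      g', A0, A1, A2, A3, B, B', C, C', D, D', E, E', F, F', G, G', Matrix.smul_apply,
      Matrix.add_apply, Matrix.one_apply] <;>
    apply Complex.ext <;> simp <;> ring

lemma re_trace_mul_kronecker (ρ : Matrix TwoQubit TwoQubit ℂ) (α β : Matrix (Fin 2) (Fin 2) ℂ) :
    (ρ * (α ⊗ₖ β)).trace.re
      = ∑ i, ∑ j, ∑ k, ∑ l, (ρ (i, j) (k, l) * (α k i * β l j)).re := by
  simp only [Matrix.trace, diag_apply, Matrix.mul_apply, kroneckerMap_apply,
    Fintype.sum_prod_type, Complex.re_sum]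

/-- A Hermitian operator of trace one is determined by its Bloch vectors and correlations. -/
lemma eq_canonicalState {ρ : Matrix TwoQubit TwoQubit ℂ} (hH : ρ.IsHermitian)
    (htr : ρ.trace = 1) :
    ρ = canonicalState (blochFirst ρ) (blochSecond ρ) (correlationMatrix ρ) := by
  obtain ⟨⟨a0, a1, a2, a3⟩, ⟨b, b'⟩, ⟨c, c'⟩, ⟨d, d'⟩, ⟨e, e'⟩, ⟨f, f'⟩, ⟨g, g'⟩⟩ :=
    canonicalState_apply (blochFirst ρ) (blochSecond ρ) (correlationMatrix ρ)
  have hre : ∀ p q, (ρ q p).re = (ρ p q).re := fun p q => by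
    simpa using congrArg Complex.re (hH.apply p q)
  have him : ∀ p q, (ρ q p).im = -(ρ p q).im := fun p q => by
    have := congrArg Complex.im (hH.apply p q)
    simp at this; linarith
  have him0 : ∀ p, (ρ p p).im = 0 := fun p => by linarith [him p p]
  have htr' : (ρ (0, 0) (0, 0)).re + (ρ (0, 1) (0, 1)).re
      + ((ρ (1, 0) (1, 0)).re + (ρ (1, 1) (1, 1)).re) = 1 := by
    simpa [Matrix.trace, Fintype.sum_prod_type] using congrArg Complex.re htr
  have h1 := hre (0, 0) (0, 1)
  have i1 := him (0, 0) (0, 1)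
  have h2 := hre (0, 0) (1, 0)
  have i2 := him (0, 0) (1, 0)
  have h3 := hre (0, 0) (1, 1)
  have i3 := him (0, 0) (1, 1)
  have h4 := hre (0, 1) (1, 0)
  have i4 := him (0, 1) (1, 0)
  have h5 := hre (0, 1) (1, 1)
  have i5 := him (0, 1) (1, 1)
  have h6 := hre (1, 0) (1, 1)
  have i6 := him (1, 0) (1, 1)
  -- the Bloch data in terms of the entries above the diagonal, by Hermitian symmetry
  have hb :
      blochFirst ρ 0 = 2 * (ρ (0, 0) (1, 0)).re + 2 * (ρ (0, 1) (1, 1)).re ∧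
      blochFirst ρ 1 = -2 * (ρ (0, 0) (1, 0)).im - 2 * (ρ (0, 1) (1, 1)).im ∧
      blochFirst ρ 2 = (ρ (0, 0) (0, 0)).re + (ρ (0, 1) (0, 1)).re
        - (ρ (1, 0) (1, 0)).re - (ρ (1, 1) (1, 1)).re ∧
      blochSecond ρ 0 = 2 * (ρ (0, 0) (0, 1)).re + 2 * (ρ (1, 0) (1, 1)).re ∧
      blochSecond ρ 1 = -2 * (ρ (0, 0) (0, 1)).im - 2 * (ρ (1, 0) (1, 1)).im ∧
      blochSecond ρ 2 = (ρ (0, 0) (0, 0)).re - (ρ (0, 1) (0, 1)).re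
        + (ρ (1, 0) (1, 0)).re - (ρ (1, 1) (1, 1)).re ∧
      correlationMatrix ρ 0 0 = 2 * (ρ (0, 0) (1, 1)).re + 2 * (ρ (0, 1) (1, 0)).re ∧
      correlationMatrix ρ 0 1 = -2 * (ρ (0, 0) (1, 1)).im + 2 * (ρ (0, 1) (1, 0)).im ∧
      correlationMatrix ρ 0 2 = 2 * (ρ (0, 0) (1, 0)).re - 2 * (ρ (0, 1) (1, 1)).re ∧
      correlationMatrix ρ 1 0 = -2 * (ρ (0, 0) (1, 1)).im - 2 * (ρ (0, 1) (1, 0)).im ∧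
      correlationMatrix ρ 1 1 = -2 * (ρ (0, 0) (1, 1)).re + 2 * (ρ (0, 1) (1, 0)).re ∧
      correlationMatrix ρ 1 2 = -2 * (ρ (0, 0) (1, 0)).im + 2 * (ρ (0, 1) (1, 1)).im ∧
      correlationMatrix ρ 2 0 = 2 * (ρ (0, 0) (0, 1)).re - 2 * (ρ (1, 0) (1, 1)).re ∧
      correlationMatrix ρ 2 1 = -2 * (ρ (0, 0) (0, 1)).im + 2 * (ρ (1, 0) (1, 1)).im ∧
      correlationMatrix ρ 2 2 = (ρ (0, 0) (0, 0)).re - (ρ (0, 1) (0, 1)).re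
        - (ρ (1, 0) (1, 0)).re + (ρ (1, 1) (1, 1)).re := by
    refine ⟨?_, ?_, ?_, ?_, ?_, ?_, ?_, ?_, ?_, ?_, ?_, ?_, ?_, ?_, ?_⟩ <;>
    · simp only [blochFirst, blochSecond, correlationMatrix, Matrix.of_apply,
        re_trace_mul_kronecker]
      simp only [pauli, Fin.sum_univ_two, Matrix.of_apply, cons_val, Matrix.one_apply, one_ne_zero,
        zero_ne_one, if_true, if_false]
      simp [h1, h2, h3, h4, h5, h6, i1, i2, i3, i4, i5, i6]
      try ring
  obtain ⟨x0, x1, x2, y0, y1, y2, t00, t01, t02, t10, t11, t12, t20, t21, t22⟩ := hb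
  simp only [x0, x1, x2, y0, y1, y2, t00, t01, t02, t10, t11, t12, t20, t21,
    t22] at a0 a1 a2 a3 b b' c c' d d' e e' f f' g g'
  clear x0 x1 x2 y0 y1 y2 t00 t01 t02 t10 t11 t12 t20 t21 t22
  ext ⟨i, j⟩ ⟨k, l⟩
  fin_cases i <;> fin_cases j <;> fin_cases k <;> fin_cases l <;>
    simp only [Fin.zero_eta, Fin.mk_one, a0, a1, a2, a3, b, b', c, c', d, d', e, e', f, f', g,
      g'] <;>
    apply Complex.ext <;> simp only [h1, h2, h3, h4, h5, h6, i1, i2, i3, i4, i5, i6, him0] <;>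
    linarith only [htr']

/-! ### Separability of the outputs -/

lemma one_mem_separableCone : (1 : Matrix TwoQubit TwoQubit ℂ) ∈ separableCone := by
  rw [← one_kronecker_one]
  exact kronecker_mem_separableCone PosSemidef.one PosSemidef.one

lemma posDef_smul_one {n : Type*} [DecidableEq n] {c : ℝ} (hc : 0 < c) :
    (c • (1 : Matrix n n ℂ)).PosDef := by
  have h := (PosDef.one (n := n) (R := ℂ)).smul (a := (c : ℂ)) (by exact_mod_cast hc)
  rwa [Complex.coe_smul] at h

lemma posDef_localShrink {ρ : Matrix TwoQubit TwoQubit ℂ} (hρ : IsDensityOperator ρ) :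
    (localShrink ρ).PosDef := by
  rw [localShrink, hρ.2, one_smul]
  refine PosDef.posSemidef_add (PosSemidef.add (PosSemidef.add ?_ ?_) ?_)
    (posDef_smul_one (by norm_num))
  · exact posSemidef_real_smul (by norm_num) hρ.1
  · exact posSemidef_real_smul (by norm_num)
      ((posSemidef_reducedFirst hρ.1).kronecker PosSemidef.one)
  · exact posSemidef_real_smul (by norm_num)
      (PosSemidef.one.kronecker (posSemidef_reducedSecond hρ.1))

lemma posDef_nonlocalShrink {ρ : Matrix TwoQubit TwoQubit ℂ} (hρ : IsDensityOperator ρ) :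
    (nonlocalShrink ρ).PosDef := by
  rw [nonlocalShrink, hρ.2, one_smul]
  exact PosDef.posSemidef_add (posSemidef_real_smul (by norm_num) hρ.1)
    (posDef_smul_one (by norm_num))

lemma localShrink_mem_separableCone {ρ : Matrix TwoQubit TwoQubit ℂ} (hρ : IsDensityOperator ρ)
    (h : ρ ∈ separableCone) : localShrink ρ ∈ separableCone := by
  rw [localShrink, hρ.2, one_smul]
  refine add_mem (add_mem (add_mem ?_ ?_) ?_) ?_ <;>
    refine smul_mem_separableCone (by norm_num) ?_
  · exact h
  · exact kronecker_mem_separableCone (posSemidef_reducedFirst hρ.1) PosSemidef.one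
  · exact kronecker_mem_separableCone PosSemidef.one (posSemidef_reducedSecond hρ.1)
  · exact one_mem_separableCone

lemma nonlocalShrink_mem_separableCone {ρ : Matrix TwoQubit TwoQubit ℂ} (hρ : IsDensityOperator ρ)
    (h : ρ ∈ separableCone) : nonlocalShrink ρ ∈ separableCone := by
  rw [nonlocalShrink, hρ.2, one_smul]
  exact add_mem (smul_mem_separableCone (by norm_num) h)
    (smul_mem_separableCone (by norm_num) one_mem_separableCone)

lemma isSeparableState_local_pair_iff (x : Fin 3 → ℝ)
    (h : (canonicalState ((2 / 3 : ℝ) • x) ((2 / 3 : ℝ) • x) ((1 / 3 : ℝ) • 1)).PosSemidef) :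
    IsSeparableState (canonicalState ((2 / 3 : ℝ) • x) ((2 / 3 : ℝ) • x) ((1 / 3 : ℝ) • 1)) ↔
      (0 ≤ sqNorm x ∧ sqNorm x ≤ 3 / 4) ∧ sqNorm x ≤ 1 + x 2 + x 2 ^ 2 := by
  rw [isSeparableState_symmetric_iff (by norm_num) x h]
  have h0 : 0 ≤ sqNorm x := Finset.sum_nonneg fun i _ => sq_nonneg _
  -- the last condition is implied: `1 + x₃ + x₃² = (x₃ + 1/2)² + 3/4`
  constructor
  · intro h
    exact ⟨⟨h0, by linarith⟩, by nlinarith [sq_nonneg (x 2 + 1 / 2)]⟩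
  · rintro ⟨⟨-, h⟩, -⟩
    linarith

lemma isSeparableState_nonlocal_pair_iff (x : Fin 3 → ℝ)
    (h : (canonicalState ((3 / 5 : ℝ) • x) ((3 / 5 : ℝ) • x) ((1 / 5 : ℝ) • 1)).PosSemidef) :
    IsSeparableState (canonicalState ((3 / 5 : ℝ) • x) ((3 / 5 : ℝ) • x) ((1 / 5 : ℝ) • 1)) ↔
      (0 ≤ sqNorm x ∧ sqNorm x ≤ 8 / 9) ∧ sqNorm x - x 2 ^ 2 ≤ 4 / 3 * (1 + x 2) := by
  rw [isSeparableState_symmetric_iff (by norm_num) x h]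
  have h0 : 0 ≤ sqNorm x := Finset.sum_nonneg fun i _ => sq_nonneg _
  -- the last condition is implied: `4/3 + (4/3) x₃ + x₃² = (x₃ + 2/3)² + 8/9`
  constructor
  · intro h
    exact ⟨⟨h0, by linarith⟩, by nlinarith [sq_nonneg (x 2 + 2 / 3)]⟩
  · rintro ⟨⟨-, h⟩, -⟩
    linarith

theorem mainTheorem7 {κA κB κN : Type*} [Fintype κA] [Fintype κB] [Fintype κN]
    (A : BHMachine (Fin 2) κA) (B : BHMachine (Fin 2) κB) (N : BHMachine TwoQubit κN)
    (ρ : Matrix TwoQubit TwoQubit ℂ) (hρ : IsDensityOperator ρ)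
    (x y : Fin 3 → ℝ) (T : Matrix (Fin 3) (Fin 3) ℝ)
    (hx : x = blochFirst ρ) (hy : y = blochSecond ρ) (hT : T = correlationMatrix ρ) :
    ρ = canonicalState x y T ∧
    -- local cloner: the output states
    (marginal14 (localOutput A B ρ)
        = canonicalState ((2 / 3 : ℝ) • x) ((2 / 3 : ℝ) • y) ((4 / 9 : ℝ) • T) ∧
      marginal32 (localOutput A B ρ)
        = canonicalState ((2 / 3 : ℝ) • x) ((2 / 3 : ℝ) • y) ((4 / 9 : ℝ) • T) ∧
      marginal13 (localOutput A B ρ)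
        = canonicalState ((2 / 3 : ℝ) • x) ((2 / 3 : ℝ) • x) ((1 / 3 : ℝ) • 1) ∧
      marginal24 (localOutput A B ρ)
        = canonicalState ((2 / 3 : ℝ) • y) ((2 / 3 : ℝ) • y) ((1 / 3 : ℝ) • 1)) ∧
    -- local cloner: separability of each party's own pair
    ((IsSeparableState (marginal13 (localOutput A B ρ)) ↔
        (0 ≤ sqNorm x ∧ sqNorm x ≤ 3 / 4) ∧ sqNorm x ≤ 1 + x 2 + x 2 ^ 2) ∧
      (IsSeparableState (marginal24 (localOutput A B ρ)) ↔
        (0 ≤ sqNorm y ∧ sqNorm y ≤ 3 / 4) ∧ sqNorm y ≤ 1 + y 2 + y 2 ^ 2)) ∧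
    -- local cloner: the determinants and inseparability of the cross outputs
    ((detW2 (marginal14 (localOutput A B ρ)) = (W2l x y T : ℂ) ∧
        detW3 (marginal14 (localOutput A B ρ)) = (W3l x y T : ℂ) ∧
        detW4 (marginal14 (localOutput A B ρ)) = (W4l x y T : ℂ)) ∧
      (detW2 (marginal32 (localOutput A B ρ)) = (W2l x y T : ℂ) ∧
        detW3 (marginal32 (localOutput A B ρ)) = (W3l x y T : ℂ) ∧
        detW4 (marginal32 (localOutput A B ρ)) = (W4l x y T : ℂ)) ∧
      (¬ IsSeparableState (marginal14 (localOutput A B ρ)) ↔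
        (W3l x y T < 0 ∨ W4l x y T < 0) ∧ 0 ≤ W2l x y T) ∧
      (¬ IsSeparableState (marginal32 (localOutput A B ρ)) ↔
        (W3l x y T < 0 ∨ W4l x y T < 0) ∧ 0 ≤ W2l x y T)) ∧
    -- local cloner: the optimal broadcasting range
    (BroadcastOptimallyLocally A B ρ ↔
      ((W3l x y T < 0 ∨ W4l x y T < 0) ∧ 0 ≤ W2l x y T) ∧
      ((0 ≤ sqNorm x ∧ sqNorm x ≤ 3 / 4) ∧ sqNorm x ≤ 1 + x 2 + x 2 ^ 2) ∧
      ((0 ≤ sqNorm y ∧ sqNorm y ≤ 3 / 4) ∧ sqNorm y ≤ 1 + y 2 + y 2 ^ 2)) ∧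
    -- nonlocal cloner: the output states
    (marginal12 (nonlocalOutput N ρ)
        = canonicalState ((3 / 5 : ℝ) • x) ((3 / 5 : ℝ) • y) ((3 / 5 : ℝ) • T) ∧
      marginal34 (nonlocalOutput N ρ)
        = canonicalState ((3 / 5 : ℝ) • x) ((3 / 5 : ℝ) • y) ((3 / 5 : ℝ) • T) ∧
      marginal13 (nonlocalOutput N ρ)
        = canonicalState ((3 / 5 : ℝ) • x) ((3 / 5 : ℝ) • x) ((1 / 5 : ℝ) • 1) ∧
      marginal24 (nonlocalOutput N ρ)
        = canonicalState ((3 / 5 : ℝ) • y) ((3 / 5 : ℝ) • y) ((1 / 5 : ℝ) • 1)) ∧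
    -- nonlocal cloner: separability of the remaining outputs
    ((IsSeparableState (marginal13 (nonlocalOutput N ρ)) ↔
        (0 ≤ sqNorm x ∧ sqNorm x ≤ 8 / 9) ∧ sqNorm x - x 2 ^ 2 ≤ 4 / 3 * (1 + x 2)) ∧
      (IsSeparableState (marginal24 (nonlocalOutput N ρ)) ↔
        (0 ≤ sqNorm y ∧ sqNorm y ≤ 8 / 9) ∧ sqNorm y - y 2 ^ 2 ≤ 4 / 3 * (1 + y 2))) ∧
    -- nonlocal cloner: the determinants and inseparability of the desired outputs
    ((detW2 (marginal12 (nonlocalOutput N ρ)) = (W2nl x y T : ℂ) ∧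
        detW3 (marginal12 (nonlocalOutput N ρ)) = (W3nl x y T : ℂ) ∧
        detW4 (marginal12 (nonlocalOutput N ρ)) = (W4nl x y T : ℂ)) ∧
      (detW2 (marginal34 (nonlocalOutput N ρ)) = (W2nl x y T : ℂ) ∧
        detW3 (marginal34 (nonlocalOutput N ρ)) = (W3nl x y T : ℂ) ∧
        detW4 (marginal34 (nonlocalOutput N ρ)) = (W4nl x y T : ℂ)) ∧
      (¬ IsSeparableState (marginal12 (nonlocalOutput N ρ)) ↔
        (W3nl x y T < 0 ∨ W4nl x y T < 0) ∧ 0 ≤ W2nl x y T) ∧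
      (¬ IsSeparableState (marginal34 (nonlocalOutput N ρ)) ↔
        (W3nl x y T < 0 ∨ W4nl x y T < 0) ∧ 0 ≤ W2nl x y T)) ∧
    -- nonlocal cloner: the optimal broadcasting range
    (BroadcastOptimallyNonlocally N ρ ↔
      ((W3nl x y T < 0 ∨ W4nl x y T < 0) ∧ 0 ≤ W2nl x y T) ∧
      ((0 ≤ sqNorm x ∧ sqNorm x ≤ 8 / 9) ∧ sqNorm x - x 2 ^ 2 ≤ 4 / 3 * (1 + x 2)) ∧
      ((0 ≤ sqNorm y ∧ sqNorm y ≤ 8 / 9) ∧ sqNorm y - y 2 ^ 2 ≤ 4 / 3 * (1 + y 2))) := by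
  have hcan : ρ = canonicalState x y T := by
    rw [hx, hy, hT]; exact eq_canonicalState hρ.1.1 hρ.2
  have hF : reducedFirst ρ = qubitState x := by
    rw [hcan]; exact reducedFirst_canonicalState x y T
  have hS : reducedSecond ρ = qubitState y := by
    rw [hcan]; exact reducedSecond_canonicalState x y T
  have hL : localShrink ρ
      = canonicalState ((2 / 3 : ℝ) • x) ((2 / 3 : ℝ) • y) ((4 / 9 : ℝ) • T) := by
    rw [hcan]; exact localShrink_canonicalState x y T
  have hN : nonlocalShrink ρ
      = canonicalState ((3 / 5 : ℝ) • x) ((3 / 5 : ℝ) • y) ((3 / 5 : ℝ) • T) := by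
    rw [hcan]; exact nonlocalShrink_canonicalState x y T
  have l14 := (marginal14_localOutput A B ρ).trans hL
  have l32 := (marginal32_localOutput A B ρ).trans hL
  have l13 := marginal13_localOutput A B ρ
  have l24 := marginal24_localOutput A B ρ
  rw [hF, symmetrized_qubitState] at l13
  rw [hS, symmetrized_qubitState] at l24
  have n12 := (marginal12_nonlocalOutput N ρ).trans hN
  have n34 := (marginal34_nonlocalOutput N ρ).trans hN
  have n13 := marginal13_nonlocalOutput N ρ
  have n24 := marginal24_nonlocalOutput N ρ
  rw [hF, symmetrized_add_noise_qubitState] at n13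
  rw [hS, symmetrized_add_noise_qubitState] at n24
  have sl13 := isSeparableState_local_pair_iff x
    (l13 ▸ posSemidef_marginal13 (posSemidef_localOutput A B hρ.1))
  have sl24 := isSeparableState_local_pair_iff y
    (l24 ▸ posSemidef_marginal24 (posSemidef_localOutput A B hρ.1))
  have sn13 := isSeparableState_nonlocal_pair_iff x
    (n13 ▸ posSemidef_marginal13 (posSemidef_nonlocalOutput N hρ.1))
  have sn24 := isSeparableState_nonlocal_pair_iff y
    (n24 ▸ posSemidef_marginal24 (posSemidef_nonlocalOutput N hρ.1))
  have bl := not_isSeparableState_iff_of_detW (hL ▸ posDef_localShrink hρ)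
    (trace_canonicalState _ _ _) (detW2_local x y T) (detW3_local x y T) (detW4_local x y T)
  have bn := not_isSeparableState_iff_of_detW (hN ▸ posDef_nonlocalShrink hρ)
    (trace_canonicalState _ _ _) (detW2_nonlocal x y T) (detW3_nonlocal x y T)
    (detW4_nonlocal x y T)
  -- local operations and mixing with noise create no entanglement, so that the inseparability of
  -- the input follows from that of the outputs
  have il : ¬ IsSeparableState
      (canonicalState ((2 / 3 : ℝ) • x) ((2 / 3 : ℝ) • y) ((4 / 9 : ℝ) • T)) →
      ¬ IsSeparableState ρ := fun h h' => h <|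
    (isSeparableState_iff_mem_separableCone (trace_canonicalState _ _ _)).2
      (hL ▸ localShrink_mem_separableCone hρ h'.mem_separableCone)
  have inl : ¬ IsSeparableState
      (canonicalState ((3 / 5 : ℝ) • x) ((3 / 5 : ℝ) • y) ((3 / 5 : ℝ) • T)) →
      ¬ IsSeparableState ρ := fun h h' => h <|
    (isSeparableState_iff_mem_separableCone (trace_canonicalState _ _ _)).2
      (hN ▸ nonlocalShrink_mem_separableCone hρ h'.mem_separableCone)
  have dl := And.intro (detW2_local x y T) (And.intro (detW3_local x y T) (detW4_local x y T))
  have dn := And.intro (detW2_nonlocal x y T)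
    (And.intro (detW3_nonlocal x y T) (detW4_nonlocal x y T))
  unfold BroadcastOptimallyLocally BroadcastOptimallyNonlocally
  rw [l14, l32, l13, l24, n12, n34, n13, n24]
  refine ⟨hcan, ⟨rfl, rfl, rfl, rfl⟩, ⟨sl13, sl24⟩, ⟨dl, dl, bl, bl⟩, ?_,
    ⟨rfl, rfl, rfl, rfl⟩, ⟨sn13, sn24⟩, ⟨dn, dn, bn, bn⟩, ?_⟩
  · rw [← bl, ← sl13, ← sl24]
    exact ⟨fun h => ⟨h.2.1.1, h.2.2⟩, fun h => ⟨il h.1, ⟨h.1, h.1⟩, h.2⟩⟩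
  · rw [← bn, ← sn13, ← sn24]
    exact ⟨fun h => ⟨h.2.1.1, h.2.2⟩, fun h => ⟨inl h.1, ⟨h.1, h.1⟩, h.2⟩⟩
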